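/- **Conventions.** Rings are associative and unital. Let $\mathcal C$ be an additive bicategory: the sets of 2-morphisms are abelian groups, vertical composition $\circ$ and horizontal composition $\times$ are biadditive, and every category of 1-morphisms between two given objects has finite direct sums (in particular a zero object). Let $\iota$ be a Frobenius 1-morphism of $\mathcal C$, that is, a 1-morphism with a two-sided dual $\bar\iota$, given by 2-morphisms $\mathrm{ev}_L:\bar\iota\times\iota\to 1$, $\mathrm{coev}_L:1\to\iota\times\bar\iota$, $\mathrm{ev}_R:\iota\times\bar\iota\to 1$, $\mathrm{coev}_R:1\to\bar\iota\times\iota$ such that $(\mathrm{ev}_L,\mathrm{coev}_L)$ and $(\mathrm{ev}_R,\mathrm{coev}_R)$ each satisfy the two triangle identities. Assume that $\iota$ has depth 2: $(\iota\times\bar\iota)\times\iota$ is a direct summand (retract) of a finite direct sum of copies of $\iota$, and $(\bar\iota\times\iota)\times\bar\iota$ is one of a finite direct sum of copies of $\bar\iota$. Put $L=\mathrm{End}(\iota)$, $R=\mathrm{End}(\bar\iota)$, $A=\mathrm{End}(\iota\times\bar\iota)$, $B=\mathrm{End}(\bar\iota\times\iota)$, rings under $\circ$. Coherence isomorphisms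 are suppressed, and $\iota$, $\bar\iota$ also denote identity 2-morphisms. **Hopf algebroids.** A *left bialgebroid* $(A,L,s_L,t_L,\gamma_L,\pi_L)$ consists of rings $A$, $L$, ring homomorphisms $s_L:L\to A$, $t_L:L^{op}\to A$ with commuting images, and maps $\gamma_L:A\to A_L\otimes{}_LA$, $a\mapsto a_{(1)}\otimes a_{(2)}$, and $\pi_L:A\to L$ that make $A$, with $l\cdot a\cdot l'=s_L(l)t_L(l')a$, a comonoid in $L$-$L$-bimodules, such that $a_{(1)}t_L(l)\otimes a_{(2)}=a_{(1)}\otimes a_{(2)}s_L(l)$, $\gamma_L(1)=1\otimes1$, $\gamma_L(ab)=\gamma_L(a)\gamma_L(b)$, $\pi_L(1)=1$, $\pi_L(a\,s_L\pi_L(b))=\pi_L(ab)=\pi_L(a\,t_L\pi_L(b))$. A *right bialgebroid* $(A,R,s_R,t_R,\gamma_R,\pi_R)$ is the mirror notion: $r\cdot a\cdot r'=a\,s_R(r')t_R(r)$, $\gamma_R(a)=a^{(1)}\otimes a^{(2)}\in A^R\otimes{}^RA$, $s_R(r)a^{(1)}\otimes a^{(2)}=a^{(1)}\otimes t_R(r)a^{(2)}$,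 $\gamma_R(1)=1\otimes1$, $\gamma_R(ab)=\gamma_R(a)\gamma_R(b)$, $\pi_R(1)=1$, $\pi_R(s_R\pi_R(a)b)=\pi_R(ab)=\pi_R(t_R\pi_R(a)b)$. A *Hopf algebroid* consists of a left bialgebroid over $L$ and a right bialgebroid over $R\simeq L^{op}$ on the same ring $A$ and an additive bijection $S:A\to A$ with $s_L(L)=t_R(R)$, $t_L(L)=s_R(R)$, $(\gamma_L\otimes\mathrm{id})\gamma_R=(\mathrm{id}\otimes\gamma_R)\gamma_L$, $(\gamma_R\otimes\mathrm{id})\gamma_L=(\mathrm{id}\otimes\gamma_L)\gamma_R$, $S(t_L(l)a\,t_L(l'))=s_L(l')S(a)s_L(l)$, $S(t_R(r')a\,t_R(r))=s_R(r)S(a)s_R(r')$, $S(a_{(1)})a_{(2)}=s_R\pi_R(a)$, $a^{(1)}S(a^{(2)})=s_L\pi_L(a)$. A *strict isomorphism* $(\Phi,\phi)$ of Hopf algebroids is a pair of bijective ring homomorphisms of the total rings and of the left base rings that commute with the maps $s_L,t_L,\pi_L,\gamma_L$ and satisfy $\Phi\circ S=S'\circ\Phi$. The *dual* $\mathcal A^*$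 of a right bialgebroid is the ring of additive maps $\phi:A\to R$ with $\phi(a\,s_R(r))=\phi(a)r$, with product $(\phi\psi)(a)=\phi(a^{(2)}t_R(\psi(a^{(1)})))$ and unit $\pi_R$; put $\phi\rightharpoonup a=a^{(2)}t_R(\phi(a^{(1)}))$ and $(\phi\leftharpoonup a)(b)=\phi(ab)$. A *two-sided non-degenerate integral* $i\in A$ satisfies $ai=s_L\pi_L(a)i$ and $ia=i\,s_R\pi_R(a)$ for all $a\in A$, and the map $i_R:\mathcal A^*\to A$, $\phi\mapsto\phi\rightharpoonup i$, as well as the map $\phi\mapsto i^{(1)}s_R(\phi(i^{(2)}))$, defined on the additive maps $\phi:A\to R$ with $\phi(a\,t_R(r))=r\phi(a)$, are bijective onto $A$. For such $i$ let $\mathcal A^*_i$ denote the ring $\mathcal A^*$ with the following structure maps (left base $R$, right base $L$), where $\lambda^*=i_R^{-1}(1)$: $$s_L^*(r)(a)=r\,\pi_R(a),\quad t_L^*(r)(a)=\pi_R(s_R(r)a),\quad \gamma_L^*(\phi)=\phi\leftharpoonup i^{(1)}\otimes i_R^{-1}(i^{(2)}),\quad \pi_L^*(\phi)=\phi(1),$$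 $$s_R^*(l)(a)=\pi_R(s_L(l)a),\quad t_R^*(l)(a)=\lambda^*(S(i\,t_L(l))a),\quad \gamma_R^*(\phi)=\phi\leftharpoonup S^2(i^{(2)})\otimes i_R^{-1}(i^{(1)}),\quad \pi_R^*(\phi)=\pi_L s_R\big((\lambda^*\phi)(i)\big),$$ $$S^*=i_R^{-1}\circ S\circ i_R.$$ **The structures on $A$ and $B$.** Put $$a_1\ast a_2=(\iota\times\mathrm{ev}_L\times\bar\iota)\circ(a_1\times a_2)\circ(\iota\times\mathrm{coev}_R\times\bar\iota),\qquad b_1\ast b_2=(\bar\iota\times\mathrm{ev}_R\times\iota)\circ(b_1\times b_2)\circ(\bar\iota\times\mathrm{coev}_L\times\iota),$$ $$\mathcal F(a)=(\bar\iota\times\iota\times\mathrm{ev}_L)\circ(\bar\iota\times a\times\iota)\circ(\mathrm{coev}_R\times\bar\iota\times\iota),\qquad \dot{\mathcal F}(a)=(\mathrm{ev}_L\times\bar\iota\times\iota)\circ(\bar\iota\times a\times\iota)\circ(\bar\iota\times\iota\times\mathrm{coev}_R),$$ which are bijections $A\to B$ with inverses $\mathcal F^{-1}(b)=(\mathrm{ev}_R\times\iota\times\bar\iota)\circ(\iota\times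 b\times\bar\iota)\circ(\iota\times\bar\iota\times\mathrm{coev}_L)$ and $\dot{\mathcal F}^{-1}(b)=(\iota\times\bar\iota\times\mathrm{ev}_R)\circ(\iota\times b\times\bar\iota)\circ(\mathrm{coev}_L\times\iota\times\bar\iota)$. Let $S_A=\dot{\mathcal F}^{-1}\circ\mathcal F$, $S_B=\mathcal F\circ\dot{\mathcal F}^{-1}$, $i_A=\mathrm{coev}_L\circ\mathrm{ev}_R$, and for $l\in L$, $a\in A$ $$\mu(l)=(\mathrm{ev}_L\times\bar\iota)\circ(\bar\iota\times l\times\bar\iota)\circ(\bar\iota\times\mathrm{coev}_L),\qquad \nu(l)=(\bar\iota\times\mathrm{ev}_R)\circ(\bar\iota\times l\times\bar\iota)\circ(\mathrm{coev}_R\times\bar\iota),$$ $$\varphi_L(a)=(\iota\times\mathrm{ev}_L)\circ(a\times\iota)\circ(\iota\times\mathrm{coev}_R)\in L,$$ where $\nu:L\to R^{op}$ is bijective. A *D2 quasi-basis* is a finite family $(y_j,x_j)$ in $A$ with $\sum_j(y_j\times\iota)\circ(\iota\times\mathrm{coev}_R)\circ(\iota\times\mathrm{ev}_L)\circ(x_j\times\iota)=\mathrm{id}_{(\iota\times\bar\iota)\times\iota}$.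 Let $\mathcal A$ be the ring $A$ with antipode $S_A$ and $$s_L(l)=l\times\bar\iota,\quad t_L(l)=\iota\times\mu(l),\quad \gamma_L(a)=\sum_j a\ast S_A^{-1}(y_j)\otimes x_j=\sum_j S_A^{-1}(y_j)\otimes x_j\ast a,\quad \pi_L(a)=\varphi_L(a\circ i_A),$$ $$s_R(r)=\iota\times r,\quad t_R(r)=\nu^{-1}(r)\times\bar\iota,\quad \gamma_R(a)=\sum_j a\ast S_A(x_j)\otimes y_j=\sum_j S_A(x_j)\otimes y_j\ast a,\quad \pi_R(a)=\nu\varphi_L(S_A^{-1}(a)\circ i_A),$$ and let $\mathcal B$ be the ring $B$ (left base $R$, right base $L$) with antipode $S_B$ and $$s_L(r)=r\times\iota,\quad t_L(r)=\bar\iota\times\nu^{-1}(r),\quad \gamma_L(b)=\sum_j b\ast\mathcal F(x_j)\otimes\mathcal F(y_j)=\sum_j\mathcal F(x_j)\otimes\mathcal F(y_j)\ast b,\quad \pi_L(b)=\nu\varphi_L\mathcal F^{-1}(b),$$ $$s_R(l)=\bar\iota\times l,\quad t_R(l)=\mu(l)\times\iota,\quad \gamma_R(b)=\sum_j b\ast\dot{\mathcal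 F}(y_j)\otimes\dot{\mathcal F}(x_j)=\sum_j\dot{\mathcal F}(y_j)\otimes\dot{\mathcal F}(x_j)\ast b,\quad \pi_R(b)=\varphi_L\dot{\mathcal F}^{-1}(b).$$ **Theorem.** A D2 quasi-basis exists. For every choice of it, $\mathcal A$ and $\mathcal B$ are Hopf algebroids, which do not depend on the choice. The element $i_A$ is a two-sided non-degenerate integral in $\mathcal A$, and $\mathcal A^*_{i_A}$ is a well-defined Hopf algebroid. The map $$\alpha^*:B\to\mathcal A^*,\qquad \alpha^*(b)(a)=\nu\,\varphi_L\big(S_A^{-1}(a)\circ\mathcal F^{-1}(b)\big),$$ is a ring isomorphism, and $(\alpha^*,\mathrm{id}_R)$ is a strict isomorphism of Hopf algebroids from $\mathcal B$ to $\mathcal A^*_{i_A}$. -/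

import Mathlib

open CategoryTheory CategoryTheory.Bicategory CategoryTheory.Limits
open scoped TensorProduct

/-! ## Tensor products over a noncommutative ring -/

section Balanced

variable {J J' K M N P M' N' : Type*}
  [AddCommGroup M] [AddCommGroup N] [AddCommGroup P] [AddCommGroup M'] [AddCommGroup N']

/-- The tensor product of a right module `M` (action `m · j = ρ j m`) and a left module `N`
(action `j · n = κ j n`): the quotient of the tensor product of abelian groups `M ⊗ N` by the
subgroup generated by the elements `(m · j) ⊗ n - m ⊗ (j · n)`. -/
def BalTensor (ρ : J → M →+ M) (κ : J → N →+ N) : Type _ :=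
  (M ⊗[ℤ] N) ⧸ AddSubgroup.closure
    {z : M ⊗[ℤ] N | ∃ (j : J) (m : M) (n : N), z = ρ j m ⊗ₜ[ℤ] n - m ⊗ₜ[ℤ] κ j n}

namespace BalTensor

noncomputable instance (ρ : J → M →+ M) (κ : J → N →+ N) : AddCommGroup (BalTensor ρ κ) :=
  inferInstanceAs (AddCommGroup ((M ⊗[ℤ] N) ⧸ AddSubgroup.closure
    {z : M ⊗[ℤ] N | ∃ (j : J) (m : M) (n : N), z = ρ j m ⊗ₜ[ℤ] n - m ⊗ₜ[ℤ] κ j n}))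

/-- The canonical projection from the tensor product of abelian groups. -/
noncomputable def mk (ρ : J → M →+ M) (κ : J → N →+ N) : M ⊗[ℤ] N →+ BalTensor ρ κ :=
  QuotientAddGroup.mk' _

/-- The class of an elementary tensor. -/
noncomputable def tmul (ρ : J → M →+ M) (κ : J → N →+ N) (m : M) (n : N) : BalTensor ρ κ :=
  mk ρ κ (m ⊗ₜ[ℤ] n)

variable {ρ : J → M →+ M} {κ : J → N →+ N} {ρ' : J → M' →+ M'} {κ' : J → N' →+ N'}

theorem balanced (j : J) (m : M) (n : N) : tmul ρ κ (ρ j m) n = tmul ρ κ m (κ j n) := by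
  have h : mk ρ κ (ρ j m ⊗ₜ[ℤ] n - m ⊗ₜ[ℤ] κ j n) = 0 :=
    (QuotientAddGroup.eq_zero_iff _).2 (AddSubgroup.subset_closure ⟨j, m, n, rfl⟩)
  rw [map_sub, sub_eq_zero] at h
  exact h

theorem tmul_add (m : M) (n n' : N) :
    tmul ρ κ m (n + n') = tmul ρ κ m n + tmul ρ κ m n' := by
  simp only [tmul, TensorProduct.tmul_add, map_add]

theorem add_tmul (m m' : M) (n : N) :
    tmul ρ κ (m + m') n = tmul ρ κ m n + tmul ρ κ m' n := by
  simp only [tmul, TensorProduct.add_tmul, map_add]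

theorem exists_sum (z : BalTensor ρ κ) :
    ∃ (n : ℕ) (u : Fin n → M) (v : Fin n → N), z = ∑ i, tmul ρ κ (u i) (v i) := by
  obtain ⟨w, rfl⟩ := QuotientAddGroup.mk'_surjective _ z
  change ∃ (n : ℕ) (u : Fin n → M) (v : Fin n → N), mk ρ κ w = _
  induction w using TensorProduct.induction_on with
  | zero => exact ⟨0, Fin.elim0, Fin.elim0, by simp⟩
  | tmul m n => exact ⟨1, fun _ => m, fun _ => n, by simp [tmul]⟩
  | add x y hx hy =>
    obtain ⟨n, u, v, h⟩ := hx
    obtain ⟨n', u', v', h'⟩ := hy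
    refine ⟨n + n', Fin.append u u', Fin.append v v', ?_⟩
    rw [map_add, h, h', Fin.sum_univ_add]
    simp

/-- Two additive maps that agree on elementary tensors are equal. -/
theorem hom_ext {f g : BalTensor ρ κ →+ P}
    (h : ∀ m n, f (tmul ρ κ m n) = g (tmul ρ κ m n)) : f = g := by
  ext z
  obtain ⟨n, u, v, rfl⟩ := exists_sum z
  simp only [map_sum, h]

/-- The universal property: a balanced biadditive map factors through the tensor product. -/
noncomputable def lift (f : M →+ N →+ P) (h : ∀ j m n, f (ρ j m) n = f m (κ j n)) :
    BalTensor ρ κ →+ P :=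
  QuotientAddGroup.lift _
    (TensorProduct.liftAddHom f fun r m n => by simp)
    (by
      rw [AddSubgroup.closure_le]
      rintro _ ⟨j, m, n, rfl⟩
      simp [AddMonoidHom.mem_ker, h])

@[simp]
theorem lift_tmul (f : M →+ N →+ P) (h : ∀ j m n, f (ρ j m) n = f m (κ j n)) (m : M) (n : N) :
    lift f h (tmul ρ κ m n) = f m n := rfl

/-- `tmul` as a biadditive map. -/
noncomputable def tmulHom (ρ : J → M →+ M) (κ : J → N →+ N) : M →+ N →+ BalTensor ρ κ :=
  AddMonoidHom.mk' (fun m => AddMonoidHom.mk' (fun n => tmul ρ κ m n) (tmul_add m))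
    (fun m m' => by ext n; exact add_tmul m m' n)

@[simp]
theorem tmulHom_apply (m : M) (n : N) : tmulHom ρ κ m n = tmul ρ κ m n := rfl

/-- The tensor product `f ⊗ g` of two module maps. -/
noncomputable def map (f : M →+ M') (g : N →+ N') (hf : ∀ j m, f (ρ j m) = ρ' j (f m))
    (hg : ∀ j n, g (κ j n) = κ' j (g n)) : BalTensor ρ κ →+ BalTensor ρ' κ' :=
  lift (((tmulHom ρ' κ').comp f).compl₂ g) (fun j m n => by
    change tmul ρ' κ' (f (ρ j m)) (g n) = tmul ρ' κ' (f m) (g (κ j n))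
    rw [hf, hg, balanced])

@[simp]
theorem map_tmul (f : M →+ M') (g : N →+ N') (hf : ∀ j m, f (ρ j m) = ρ' j (f m))
    (hg : ∀ j n, g (κ j n) = κ' j (g n)) (m : M) (n : N) :
    map f g hf hg (tmul ρ κ m n) = tmul ρ' κ' (f m) (g n) := rfl

/-- `f ⊗ id`. -/
noncomputable def mapL (f : M →+ M') (hf : ∀ j m, f (ρ j m) = ρ' j (f m)) :
    BalTensor ρ κ →+ BalTensor ρ' κ :=
  map f (AddMonoidHom.id N) hf (fun _ _ => rfl)

/-- `id ⊗ g`. -/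
noncomputable def mapR (g : N →+ N') (hg : ∀ j n, g (κ j n) = κ' j (g n)) :
    BalTensor ρ κ →+ BalTensor ρ κ' :=
  map (AddMonoidHom.id M) g (fun _ _ => rfl) hg

@[simp]
theorem mapL_tmul (f : M →+ M') (hf : ∀ j m, f (ρ j m) = ρ' j (f m)) (m : M) (n : N) :
    mapL (κ := κ) f hf (tmul ρ κ m n) = tmul ρ' κ (f m) n := rfl

@[simp]
theorem mapR_tmul (g : N →+ N') (hg : ∀ j n, g (κ j n) = κ' j (g n)) (m : M) (n : N) :
    mapR (ρ := ρ) g hg (tmul ρ κ m n) = tmul ρ κ' m (g n) := rfl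

/-- The tensor product `f ⊗ g` of two maps that are linear over a map `e` of the base rings. -/
noncomputable def mapBase {ρ₁ : J' → M' →+ M'} {κ₁ : J' → N' →+ N'} (e : J → J')
    (f : M →+ M') (g : N →+ N') (hf : ∀ j m, f (ρ j m) = ρ₁ (e j) (f m))
    (hg : ∀ j n, g (κ j n) = κ₁ (e j) (g n)) : BalTensor ρ κ →+ BalTensor ρ₁ κ₁ :=
  lift (((tmulHom ρ₁ κ₁).comp f).compl₂ g) (fun j m n => by
    change tmul ρ₁ κ₁ (f (ρ j m)) (g n) = tmul ρ₁ κ₁ (f m) (g (κ j n))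
    rw [hf, hg, balanced])

/-- The associativity map `(M ⊗ N) ⊗ P → M ⊗ (N ⊗ P)`, where the first tensor product is over
`J` and the second one over `K`, and the two actions on `N` commute. -/
noncomputable def assoc (ρ : J → M →+ M) (κ : J → N →+ N) (σ : K → N →+ N) (τ : K → P →+ P)
    (h : ∀ j k n, σ k (κ j n) = κ j (σ k n)) :
    BalTensor (fun k => mapR (ρ := ρ) (κ := κ) (κ' := κ) (σ k) (fun j n => h j k n)) τ →+
      BalTensor ρ (fun j => mapL (κ := τ) (ρ := σ) (ρ' := σ) (κ j) (fun k n => (h j k n).symm)) :=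
  lift
    (lift ((AddMonoidHom.compHom.comp (tmulHom ρ (fun j => mapL (κ := τ) (ρ := σ) (ρ' := σ) (κ j)
        (fun k n => (h j k n).symm)))).compl₂ (tmulHom σ τ))
      (fun j m n => by
        ext p
        simp only [AddMonoidHom.compl₂_apply, AddMonoidHom.comp_apply,
          AddMonoidHom.compHom_apply_apply, tmulHom_apply, balanced, mapL_tmul]))
    (fun k z p => by
      obtain ⟨n, u, v, rfl⟩ := exists_sum z
      simp only [map_sum, AddMonoidHom.finsetSum_apply, mapR_tmul, lift_tmul,
        AddMonoidHom.compl₂_apply, AddMonoidHom.comp_apply,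
        AddMonoidHom.compHom_apply_apply, tmulHom_apply, balanced])

@[simp]
theorem assoc_tmul (ρ : J → M →+ M) (κ : J → N →+ N) (σ : K → N →+ N) (τ : K → P →+ P)
    (h : ∀ j k n, σ k (κ j n) = κ j (σ k n)) (m : M) (n : N) (p : P) :
    assoc ρ κ σ τ h (tmul _ τ (tmul ρ κ m n) p) = tmul ρ _ m (tmul σ τ n p) := rfl

end BalTensor

end Balanced

/-! ## Bialgebroids -/

/-- Source and target maps: ring homomorphisms `s : L → A` and `t : Lᵒᵖ → A` whose images
commute. -/
structure SourceTarget (A L : Type*) [Ring A] [Ring L] where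
  s : L →+* A
  t : Lᵐᵒᵖ →+* A
  comm : ∀ l l' : L, s l * t (.op l') = t (.op l') * s l

namespace SourceTarget

variable {A L : Type*} [Ring A] [Ring L] (D : SourceTarget A L)

/-- `a ↦ s(l) a` -/
def sLeft (l : L) : A →+ A := AddMonoidHom.mulLeft (D.s l)
/-- `a ↦ t(l) a` -/
def tLeft (l : L) : A →+ A := AddMonoidHom.mulLeft (D.t (.op l))
/-- `a ↦ a s(l)` -/
def sRight (l : L) : A →+ A := AddMonoidHom.mulRight (D.s l)
/-- `a ↦ a t(l)` -/
def tRight (l : L) : A →+ A := AddMonoidHom.mulRight (D.t (.op l))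

@[simp] theorem sLeft_apply (l : L) (a : A) : D.sLeft l a = D.s l * a := rfl
@[simp] theorem tLeft_apply (l : L) (a : A) : D.tLeft l a = D.t (.op l) * a := rfl
@[simp] theorem sRight_apply (l : L) (a : A) : D.sRight l a = a * D.s l := rfl
@[simp] theorem tRight_apply (l : L) (a : A) : D.tRight l a = a * D.t (.op l) := rfl

/-- `A_L ⊗ _L A`, where `l · a · l' = s(l) t(l') a`: the tensor product in which
`t(l) a ⊗ b = a ⊗ s(l) b`. -/
abbrev LeftTensor : Type _ := BalTensor D.tLeft D.sLeft

/-- `A^L ⊗ ^L A`, where `l · a · l' = a s(l') t(l)`: the tensor product in which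
`a s(l) ⊗ b = a ⊗ b t(l)`. -/
abbrev RightTensor : Type _ := BalTensor D.sRight D.tRight

theorem sLeft_tLeft (l l' : L) (a : A) : D.sLeft l (D.tLeft l' a) = D.tLeft l' (D.sLeft l a) := by
  simp [sLeft, tLeft, ← mul_assoc, D.comm]

theorem sRight_tRight (l l' : L) (a : A) :
    D.sRight l (D.tRight l' a) = D.tRight l' (D.sRight l a) := by
  simp [sRight, tRight, mul_assoc, D.comm]

theorem sLeft_mulRight (l : L) (c a : A) :
    AddMonoidHom.mulRight c (D.sLeft l a) = D.sLeft l (AddMonoidHom.mulRight c a) := by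
  simp [sLeft, mul_assoc]

theorem tLeft_mulRight (l : L) (c a : A) :
    AddMonoidHom.mulRight c (D.tLeft l a) = D.tLeft l (AddMonoidHom.mulRight c a) := by
  simp [tLeft, mul_assoc]

theorem sRight_mulLeft (l : L) (c a : A) :
    AddMonoidHom.mulLeft c (D.sRight l a) = D.sRight l (AddMonoidHom.mulLeft c a) := by
  simp [sRight, mul_assoc]

theorem tRight_mulLeft (l : L) (c a : A) :
    AddMonoidHom.mulLeft c (D.tRight l a) = D.tRight l (AddMonoidHom.mulLeft c a) := by
  simp [tRight, mul_assoc]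

/-- Right multiplication by `c ⊗ d` on `A_L ⊗ _L A`: `a ⊗ b ↦ a c ⊗ b d`. -/
noncomputable def leftTensorMul (c d : A) : D.LeftTensor →+ D.LeftTensor :=
  BalTensor.map (AddMonoidHom.mulRight c) (AddMonoidHom.mulRight d)
    (fun l a => D.tLeft_mulRight l c a) (fun l a => D.sLeft_mulRight l d a)

/-- Left multiplication by `c ⊗ d` on `A^L ⊗ ^L A`: `a ⊗ b ↦ c a ⊗ d b`. -/
noncomputable def rightTensorMul (c d : A) : D.RightTensor →+ D.RightTensor :=
  BalTensor.map (AddMonoidHom.mulLeft c) (AddMonoidHom.mulLeft d)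
    (fun l a => D.sRight_mulLeft l c a) (fun l a => D.tRight_mulLeft l d a)

@[simp]
theorem leftTensorMul_tmul (c d a b : A) :
    D.leftTensorMul c d (BalTensor.tmul _ _ a b) = BalTensor.tmul _ _ (a * c) (b * d) := rfl

@[simp]
theorem rightTensorMul_tmul (c d a b : A) :
    D.rightTensorMul c d (BalTensor.tmul _ _ a b) = BalTensor.tmul _ _ (c * a) (d * b) := rfl

end SourceTarget

/-- A left bialgebroid with total ring `A` and base ring `L`. The bimodule structure is
`l · a · l' = s(l) t(l') a`. -/
structure LeftBialgebroid (A L : Type*) [Ring A] [Ring L] extends SourceTarget A L where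
  /-- the coproduct `a ↦ a₍₁₎ ⊗ a₍₂₎` -/
  γ : A →+ toSourceTarget.LeftTensor
  /-- the counit -/
  π : A →+ L
  /-- `γ` is a left `L`-module map: `γ(s(l) a) = s(l) a₍₁₎ ⊗ a₍₂₎`. -/
  γ_s_mul : ∀ l a, γ (toSourceTarget.sLeft l a) =
    BalTensor.mapL (toSourceTarget.sLeft l) (fun l' a' => toSourceTarget.sLeft_tLeft l l' a') (γ a)
  /-- `γ` is a right `L`-module map: `γ(t(l) a) = a₍₁₎ ⊗ t(l) a₍₂₎`. -/
  γ_t_mul : ∀ l a, γ (toSourceTarget.tLeft l a) =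
    BalTensor.mapR (toSourceTarget.tLeft l)
      (fun l' a' => (toSourceTarget.sLeft_tLeft l' l a').symm) (γ a)
  π_s_mul : ∀ l a, π (s l * a) = l * π a
  π_t_mul : ∀ l a, π (t (.op l) * a) = π a * l
  coassoc : ∀ a,
    BalTensor.assoc toSourceTarget.tLeft toSourceTarget.sLeft
        toSourceTarget.tLeft toSourceTarget.sLeft
        (fun l k a' => (toSourceTarget.sLeft_tLeft l k a').symm)
      (BalTensor.mapL γ (fun l a' => γ_t_mul l a') (γ a)) =
    BalTensor.mapR γ (fun l a' => γ_s_mul l a') (γ a)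
  /-- `s(π(a₍₁₎)) a₍₂₎ = a` -/
  counit_left : ∀ a,
    BalTensor.lift (AddMonoidHom.mul.comp (s.toAddMonoidHom.comp π))
      (fun l a' b' => by
        change s (π (t (.op l) * a')) * b' = s (π a') * (s l * b')
        rw [π_t_mul, map_mul, mul_assoc]) (γ a) = a
  /-- `t(π(a₍₂₎)) a₍₁₎ = a` -/
  counit_right : ∀ a,
    BalTensor.lift
      (AddMonoidHom.mul.comp ((t.toAddMonoidHom.comp MulOpposite.opAddEquiv.toAddMonoidHom).comp
        π)).flip
      (fun l a' b' => by
        change t (.op (π b')) * (t (.op l) * a') = t (.op (π (s l * b'))) * a'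
        rw [π_s_mul, MulOpposite.op_mul, map_mul, mul_assoc]) (γ a) = a
  /-- `a₍₁₎ t(l) ⊗ a₍₂₎ = a₍₁₎ ⊗ a₍₂₎ s(l)` -/
  cross : ∀ a l, toSourceTarget.leftTensorMul (t (.op l)) 1 (γ a) =
    toSourceTarget.leftTensorMul 1 (s l) (γ a)
  γ_one : γ 1 = BalTensor.tmul _ _ 1 1
  /-- `γ(a b) = γ(a) γ(b)`, where `γ(b)` may be represented by any sum `∑ᵢ cᵢ ⊗ dᵢ`. -/
  γ_mul : ∀ (a b : A) (n : ℕ) (c d : Fin n → A), γ b = ∑ i, BalTensor.tmul _ _ (c i) (d i) →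
    γ (a * b) = ∑ i, toSourceTarget.leftTensorMul (c i) (d i) (γ a)
  π_one : π 1 = 1
  π_mul_s : ∀ a b, π (a * s (π b)) = π (a * b)
  π_mul_t : ∀ a b, π (a * t (.op (π b))) = π (a * b)

/-- A right bialgebroid with total ring `A` and base ring `R`. The bimodule structure is
`r · a · r' = a s(r') t(r)`. -/
structure RightBialgebroid (A R : Type*) [Ring A] [Ring R] extends SourceTarget A R where
  /-- the coproduct `a ↦ a⁽¹⁾ ⊗ a⁽²⁾` -/
  γ : A →+ toSourceTarget.RightTensor
  /-- the counit -/
  π : A →+ R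
  /-- `γ` is a right `R`-module map: `γ(a s(r)) = a⁽¹⁾ ⊗ a⁽²⁾ s(r)`. -/
  γ_mul_s : ∀ r a, γ (toSourceTarget.sRight r a) =
    BalTensor.mapR (toSourceTarget.sRight r)
      (fun r' a' => toSourceTarget.sRight_tRight r r' a') (γ a)
  /-- `γ` is a left `R`-module map: `γ(a t(r)) = a⁽¹⁾ t(r) ⊗ a⁽²⁾`. -/
  γ_mul_t : ∀ r a, γ (toSourceTarget.tRight r a) =
    BalTensor.mapL (toSourceTarget.tRight r)
      (fun r' a' => (toSourceTarget.sRight_tRight r' r a').symm) (γ a)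
  π_mul_s : ∀ r a, π (a * s r) = π a * r
  π_mul_t : ∀ r a, π (a * t (.op r)) = r * π a
  coassoc : ∀ a,
    BalTensor.assoc toSourceTarget.sRight toSourceTarget.tRight
        toSourceTarget.sRight toSourceTarget.tRight
        (fun r k a' => toSourceTarget.sRight_tRight k r a')
      (BalTensor.mapL γ (fun r a' => γ_mul_s r a') (γ a)) =
    BalTensor.mapR γ (fun r a' => γ_mul_t r a') (γ a)
  /-- `a⁽²⁾ t(π(a⁽¹⁾)) = a` -/
  counit_left : ∀ a,
    BalTensor.lift
      (AddMonoidHom.mul.compl₂ ((t.toAddMonoidHom.comp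
        MulOpposite.opAddEquiv.toAddMonoidHom).comp π)).flip
      (fun r a' b' => by
        change b' * t (.op (π (a' * s r))) = (b' * t (.op r)) * t (.op (π a'))
        rw [π_mul_s, MulOpposite.op_mul, map_mul, mul_assoc]) (γ a) = a
  /-- `a⁽¹⁾ s(π(a⁽²⁾)) = a` -/
  counit_right : ∀ a,
    BalTensor.lift (AddMonoidHom.mul.compl₂ (s.toAddMonoidHom.comp π))
      (fun r a' b' => by
        change (a' * s r) * s (π b') = a' * s (π (b' * t (.op r)))
        rw [π_mul_t, map_mul, mul_assoc]) (γ a) = a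
  /-- `s(r) a⁽¹⁾ ⊗ a⁽²⁾ = a⁽¹⁾ ⊗ t(r) a⁽²⁾` -/
  cross : ∀ a r, toSourceTarget.rightTensorMul (s r) 1 (γ a) =
    toSourceTarget.rightTensorMul 1 (t (.op r)) (γ a)
  γ_one : γ 1 = BalTensor.tmul _ _ 1 1
  /-- `γ(a b) = γ(a) γ(b)`, where `γ(a)` may be represented by any sum `∑ᵢ cᵢ ⊗ dᵢ`. -/
  γ_mul : ∀ (a b : A) (n : ℕ) (c d : Fin n → A), γ a = ∑ i, BalTensor.tmul _ _ (c i) (d i) →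
    γ (a * b) = ∑ i, toSourceTarget.rightTensorMul (c i) (d i) (γ b)
  π_one : π 1 = 1
  π_s_mul : ∀ a b, π (s (π a) * b) = π (a * b)
  π_t_mul : ∀ a b, π (t (.op (π a)) * b) = π (a * b)

namespace LeftBialgebroid

variable {A L : Type*} [Ring A] [Ring L] (H : LeftBialgebroid A L)

theorem γ_mul_t (l : L) (a : A) : H.γ (a * H.t (.op l)) = H.leftTensorMul 1 (H.t (.op l)) (H.γ a) := by
  have h : H.γ (H.t (.op l)) = ∑ _i : Fin 1, BalTensor.tmul _ _ 1 (H.t (.op l)) := by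
    have := H.γ_t_mul l 1
    rw [SourceTarget.tLeft_apply, mul_one, H.γ_one, BalTensor.mapR_tmul] at this
    rw [this]
    simp [SourceTarget.tLeft]
  rw [H.γ_mul a _ 1 _ _ h]
  simp

theorem γ_mul_s (l : L) (a : A) : H.γ (a * H.s l) = H.leftTensorMul (H.s l) 1 (H.γ a) := by
  have h : H.γ (H.s l) = ∑ _i : Fin 1, BalTensor.tmul _ _ (H.s l) 1 := by
    have := H.γ_s_mul l 1
    rw [SourceTarget.sLeft_apply, mul_one, H.γ_one, BalTensor.mapL_tmul] at this
    rw [this]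
    simp [SourceTarget.sLeft]
  rw [H.γ_mul a _ 1 _ _ h]
  simp

end LeftBialgebroid

namespace RightBialgebroid

variable {A R : Type*} [Ring A] [Ring R] (H : RightBialgebroid A R)

theorem γ_t_mul (r : R) (a : A) : H.γ (H.t (.op r) * a) = H.rightTensorMul (H.t (.op r)) 1 (H.γ a) := by
  have h : H.γ (H.t (.op r)) = ∑ _i : Fin 1, BalTensor.tmul _ _ (H.t (.op r)) 1 := by
    have := H.γ_mul_t r 1
    rw [SourceTarget.tRight_apply, one_mul, H.γ_one, BalTensor.mapL_tmul] at this
    rw [this]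
    simp [SourceTarget.tRight]
  rw [H.γ_mul _ a 1 _ _ h]
  simp

theorem γ_s_mul (r : R) (a : A) : H.γ (H.s r * a) = H.rightTensorMul 1 (H.s r) (H.γ a) := by
  have h : H.γ (H.s r) = ∑ _i : Fin 1, BalTensor.tmul _ _ 1 (H.s r) := by
    have := H.γ_mul_s r 1
    rw [SourceTarget.sRight_apply, one_mul, H.γ_one, BalTensor.mapR_tmul] at this
    rw [this]
    simp [SourceTarget.sRight]
  rw [H.γ_mul _ a 1 _ _ h]
  simp

/-! ### Duals of a right bialgebroid -/

/-- The dual `𝒜^*`: additive maps `φ : A → R` with `φ(a s(r)) = φ(a) r`. -/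
def dualSubgroup : AddSubgroup (A →+ R) where
  carrier := {φ | ∀ a r, φ (a * H.s r) = φ a * r}
  zero_mem' := by intro a r; simp
  add_mem' := by
    intro φ ψ hφ hψ a r
    simp [hφ a r, hψ a r, add_mul]
  neg_mem' := by
    intro φ hφ a r
    simp [hφ a r]

/-- The dual `𝒜^*` of a right bialgebroid, as a type; see `instRingDual` for its product. -/
def Dual : Type _ := H.dualSubgroup

/-- The other dual `^*𝒜`: additive maps `φ : A → R` with `φ(a t(r)) = r φ(a)`. -/
def coDual : AddSubgroup (A →+ R) where
  carrier := {φ | ∀ a r, φ (a * H.t (.op r)) = r * φ a}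
  zero_mem' := by intro a r; simp
  add_mem' := by
    intro φ ψ hφ hψ a r
    simp [hφ a r, hψ a r, mul_add]
  neg_mem' := by
    intro φ hφ a r
    simp [hφ a r]

namespace Dual

variable {H}

instance : AddCommGroup H.Dual := inferInstanceAs (AddCommGroup H.dualSubgroup)

instance : FunLike H.Dual A R where
  coe φ := φ.1
  coe_injective _ _ h := Subtype.ext (DFunLike.coe_injective h)

instance : AddMonoidHomClass H.Dual A R where
  map_add φ := φ.1.map_add
  map_zero φ := φ.1.map_zero

@[ext]
theorem ext {φ ψ : H.Dual} (h : ∀ a, φ a = ψ a) : φ = ψ := DFunLike.ext _ _ h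

@[simp] theorem add_apply (φ ψ : H.Dual) (a : A) : (φ + ψ) a = φ a + ψ a := rfl

@[simp] theorem zero_apply (a : A) : (0 : H.Dual) a = 0 := rfl

theorem map_mul_s (φ : H.Dual) (a : A) (r : R) : φ (a * H.s r) = φ a * r := φ.2 a r

/-- `a ⊗ b ↦ b t(φ(a))` on `A^R ⊗ ^R A`. -/
noncomputable def actTensor (φ : H.Dual) : H.RightTensor →+ A :=
  BalTensor.lift
    (AddMonoidHom.mul.compl₂ ((H.t.toAddMonoidHom.comp
      MulOpposite.opAddEquiv.toAddMonoidHom).comp φ.1)).flip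
    (fun r a b => by
      change b * H.t (.op (φ (a * H.s r))) = (b * H.t (.op r)) * H.t (.op (φ a))
      rw [φ.map_mul_s, MulOpposite.op_mul, map_mul, mul_assoc])

@[simp]
theorem actTensor_tmul (φ : H.Dual) (a b : A) :
    φ.actTensor (BalTensor.tmul _ _ a b) = b * H.t (.op (φ a)) := rfl

/-- The action `φ ⇀ a = a⁽²⁾ t(φ(a⁽¹⁾))` of `𝒜^*` on `A`. -/
noncomputable def act (φ : H.Dual) : A →+ A := φ.actTensor.comp H.γ

theorem act_mul_s (φ : H.Dual) (a : A) (r : R) : φ.act (a * H.s r) = φ.act a * H.s r := by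
  simp only [act, AddMonoidHom.comp_apply, ← H.sRight_apply, H.γ_mul_s]
  obtain ⟨n, u, v, h⟩ := BalTensor.exists_sum (H.γ a)
  simp [h, mul_assoc, H.comm]

/-- The product `(φ ψ)(a) = φ(a⁽²⁾ t(ψ(a⁽¹⁾)))`. -/
noncomputable instance : Mul H.Dual where
  mul φ ψ := ⟨φ.1.comp ψ.act, fun a r => by
    change φ (ψ.act (a * H.s r)) = φ (ψ.act a) * r
    rw [act_mul_s, map_mul_s]⟩

/-- The unit is the counit of the bialgebroid. -/
instance : One H.Dual where
  one := ⟨H.π, fun a r => H.π_mul_s r a⟩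

theorem mul_apply (φ ψ : H.Dual) (a : A) : (φ * ψ) a = φ (ψ.act a) := rfl

theorem one_apply (a : A) : (1 : H.Dual) a = H.π a := rfl

theorem one_act (a : A) : (1 : H.Dual).act a = a := H.counit_left a

theorem add_act (φ ψ : H.Dual) (a : A) : (φ + ψ).act a = φ.act a + ψ.act a := by
  simp only [act, AddMonoidHom.comp_apply]
  obtain ⟨n, u, v, h⟩ := BalTensor.exists_sum (H.γ a)
  simp [h, mul_add, Finset.sum_add_distrib]

theorem mul_act (φ ψ : H.Dual) (a : A) : (φ * ψ).act a = φ.act (ψ.act a) := by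
  -- `a ⊗ (b ⊗ c) ↦ c t(φ(b t(ψ(a))))`
  let G : A →+ H.RightTensor →+ A := AddMonoidHom.mk'
    (fun u => φ.actTensor.comp (BalTensor.mapL (H.tRight (ψ u))
      (fun r' a' => (H.sRight_tRight r' (ψ u) a').symm)))
    (fun u u' => BalTensor.hom_ext fun m n => by
      simp [SourceTarget.tRight, mul_add])
  have hG : ∀ u m n, G u (BalTensor.tmul _ _ m n) = n * H.t (.op (φ (m * H.t (.op (ψ u))))) :=
    fun _ _ _ => rfl
  have hbal : ∀ r u w, G (H.sRight r u) w = G u (BalTensor.mapL (H.tRight r)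
      (fun k n => (H.sRight_tRight k r n).symm) w) := fun r u w => by
    obtain ⟨n, x, y, rfl⟩ := BalTensor.exists_sum w
    simp only [map_sum, BalTensor.mapL_tmul, hG]
    refine Finset.sum_congr rfl fun i _ => ?_
    simp [SourceTarget.tRight, SourceTarget.sRight, map_mul_s, mul_assoc]
  have e := congrArg (BalTensor.lift G hbal) (H.coassoc a)
  obtain ⟨n, u, v, h⟩ := BalTensor.exists_sum (H.γ a)
  have hl : (φ * ψ).act a = ∑ i, v i * H.t (.op (φ (ψ.act (u i)))) := by
    simp [act, h, mul_apply]
  have hr : φ.act (ψ.act a) = ∑ i, φ.act (v i * H.t (.op (ψ (u i)))) := by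
    have : ψ.act a = ∑ i, v i * H.t (.op (ψ (u i))) := by simp [act, h]
    rw [this, map_sum]
  rw [hl, hr]
  simp only [h, map_sum] at e
  refine Eq.trans (Finset.sum_congr rfl fun i _ => ?_)
    (e.trans (Finset.sum_congr rfl fun i _ => ?_))
  · obtain ⟨n', x, y, h'⟩ := BalTensor.exists_sum (H.γ (u i))
    have hs : BalTensor.tmul (fun k => BalTensor.mapR (ρ := H.sRight) (κ := H.tRight)
          (κ' := H.tRight) (H.sRight k) (fun j n => H.sRight_tRight k j n)) H.tRight
          (H.γ (u i)) (v i) =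
        ∑ j, BalTensor.tmul _ _ (BalTensor.tmul _ _ (x j) (y j)) (v i) := by
      rw [h', ← BalTensor.tmulHom_apply, map_sum, AddMonoidHom.finsetSum_apply]
      rfl
    rw [BalTensor.mapL_tmul, hs]
    simp only [map_sum, BalTensor.assoc_tmul, BalTensor.lift_tmul, hG]
    simp [act, h', Finset.mul_sum]
  · simp only [act, AddMonoidHom.comp_apply, ← H.tRight_apply, H.γ_mul_t]
    rfl

noncomputable instance instRingDual : Ring H.Dual where
  __ := (inferInstance : AddCommGroup H.Dual)
  mul_assoc φ ψ χ := by ext a; simp only [mul_apply, mul_act]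
  one_mul φ := by
    ext a
    rw [mul_apply, one_apply, act, AddMonoidHom.comp_apply]
    obtain ⟨n, u, v, h⟩ := BalTensor.exists_sum (H.γ a)
    have hc := congrArg φ (H.counit_right a)
    rw [h] at hc ⊢
    simp only [map_sum, BalTensor.lift_tmul, actTensor_tmul, H.π_mul_t] at hc ⊢
    rw [← hc]
    exact Finset.sum_congr rfl fun i _ => (φ.map_mul_s (u i) (H.π (v i))).symm
  mul_one φ := by ext a; rw [mul_apply, one_act]
  left_distrib φ ψ χ := by
    ext a
    rw [add_apply, mul_apply, mul_apply, mul_apply, add_act, map_add]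
  right_distrib φ ψ χ := by ext a; rfl
  zero_mul φ := by ext a; rfl
  mul_zero φ := by
    ext a
    rw [mul_apply]
    have : (0 : H.Dual).act a = 0 := by
      have := add_act (0 : H.Dual) 0 a
      simpa using this
    rw [this, map_zero]
    rfl

/-- The right `A`-action `(φ ↼ a)(b) = φ(a b)` on `𝒜^*`. -/
def precomp (φ : H.Dual) (a : A) : H.Dual :=
  ⟨φ.1.comp (AddMonoidHom.mulLeft a), fun b r => by
    change φ (a * (b * H.s r)) = φ (a * b) * r
    rw [← mul_assoc, map_mul_s]⟩

end Dual

/-- The action `φ ⇁ a = a⁽¹⁾ s(φ(a⁽²⁾))` of `^*𝒜` on `A`. -/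
noncomputable def coAct (φ : H.coDual) : A →+ A :=
  (BalTensor.lift (AddMonoidHom.mul.compl₂ (H.s.toAddMonoidHom.comp φ.1))
    (fun r a b => by
      change (a * H.s r) * H.s (φ.1 b) = a * H.s (φ.1 (b * H.t (.op r)))
      rw [φ.2 b r, map_mul, mul_assoc])).comp H.γ

end RightBialgebroid

/-! ## Hopf algebroids -/

section Compatibility

variable {A L R : Type*} [Ring A] [Ring L] [Ring R]
  (HL : LeftBialgebroid A L) (HR : RightBialgebroid A R)

theorem sRight_sLeft_comm (l : L) (r : R) (a : A) :
    HR.sRight r (HL.sLeft l a) = HL.sLeft l (HR.sRight r a) := by simp [mul_assoc]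

theorem tLeft_tRight_comm (r : R) (l : L) (a : A) :
    HL.tLeft l (HR.tRight r a) = HR.tRight r (HL.tLeft l a) := by simp [mul_assoc]

variable {HL HR}

theorem leftγ_mul_s (h : Set.range HL.t = Set.range HR.s) (r : R) (a : A) :
    HL.γ (HR.sRight r a) =
      BalTensor.mapR (HR.sRight r) (fun l a' => sRight_sLeft_comm HL HR l r a') (HL.γ a) := by
  obtain ⟨⟨l⟩, hl⟩ : HR.s r ∈ Set.range HL.t := h ▸ Set.mem_range_self r
  have := HL.γ_mul_t l a
  rw [show HL.t (MulOpposite.op l) = HR.s r from hl] at this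
  rw [HR.sRight_apply, this]
  obtain ⟨n, u, v, e⟩ := BalTensor.exists_sum (HL.γ a)
  simp [e]

theorem leftγ_mul_t (h : Set.range HL.s = Set.range HR.t) (r : R) (a : A) :
    HL.γ (HR.tRight r a) =
      BalTensor.mapL (HR.tRight r) (fun l a' => (tLeft_tRight_comm HL HR r l a').symm)
        (HL.γ a) := by
  obtain ⟨l, hl⟩ : HR.t (.op r) ∈ Set.range HL.s := h ▸ Set.mem_range_self _
  have := HL.γ_mul_s l a
  rw [hl] at this
  rw [HR.tRight_apply, this]
  obtain ⟨n, u, v, e⟩ := BalTensor.exists_sum (HL.γ a)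
  simp [e]

theorem rightγ_s_mul (h : Set.range HL.s = Set.range HR.t) (l : L) (a : A) :
    HR.γ (HL.sLeft l a) =
      BalTensor.mapL (HL.sLeft l) (fun r a' => (sRight_sLeft_comm HL HR l r a').symm)
        (HR.γ a) := by
  obtain ⟨⟨r⟩, hr⟩ : HL.s l ∈ Set.range HR.t := h ▸ Set.mem_range_self l
  have := HR.γ_t_mul r a
  rw [show HR.t (MulOpposite.op r) = HL.s l from hr] at this
  rw [HL.sLeft_apply, this]
  obtain ⟨n, u, v, e⟩ := BalTensor.exists_sum (HR.γ a)
  simp [e]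

theorem rightγ_t_mul (h : Set.range HL.t = Set.range HR.s) (l : L) (a : A) :
    HR.γ (HL.tLeft l a) =
      BalTensor.mapR (HL.tLeft l) (fun r a' => tLeft_tRight_comm HL HR r l a') (HR.γ a) := by
  obtain ⟨r, hr⟩ : HL.t (.op l) ∈ Set.range HR.s := h ▸ Set.mem_range_self _
  have := HR.γ_s_mul r a
  rw [hr] at this
  rw [HL.tLeft_apply, this]
  obtain ⟨n, u, v, e⟩ := BalTensor.exists_sum (HR.γ a)
  simp [e]

end Compatibility

/-- A Hopf algebroid: a left bialgebroid over `L` and a right bialgebroid over `R` on the same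
total ring `A`, related by an antipode `S`. -/
structure HopfAlgebroid (A L R : Type*) [Ring A] [Ring L] [Ring R] where
  left : LeftBialgebroid A L
  right : RightBialgebroid A R
  /-- the antipode -/
  S : A ≃+ A
  base_iso : Nonempty (R ≃+* Lᵐᵒᵖ)
  range_s : Set.range left.s = Set.range right.t
  range_t : Set.range left.t = Set.range right.s
  /-- `(γ_L ⊗ id) ∘ γ_R = (id ⊗ γ_R) ∘ γ_L` -/
  coassoc_left_right : ∀ a,
    BalTensor.assoc left.tLeft left.sLeft right.sRight right.tRight
        (fun l r a' => sRight_sLeft_comm left right l r a')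
      (BalTensor.mapL left.γ (fun r a' => leftγ_mul_s range_t r a') (right.γ a)) =
    BalTensor.mapR right.γ (fun l a' => rightγ_s_mul range_s l a') (left.γ a)
  /-- `(γ_R ⊗ id) ∘ γ_L = (id ⊗ γ_L) ∘ γ_R` -/
  coassoc_right_left : ∀ a,
    BalTensor.assoc right.sRight right.tRight left.tLeft left.sLeft
        (fun r l a' => tLeft_tRight_comm left right r l a')
      (BalTensor.mapL right.γ (fun l a' => rightγ_t_mul range_t l a') (left.γ a)) =
    BalTensor.mapR left.γ (fun r a' => leftγ_mul_t range_s r a') (right.γ a)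
  S_left : ∀ (l l' : L) (a : A),
    S (left.t (.op l) * a * left.t (.op l')) = left.s l' * S a * left.s l
  S_right : ∀ (r r' : R) (a : A),
    S (right.t (.op r') * a * right.t (.op r)) = right.s r * S a * right.s r'
  /-- `S(a₍₁₎) a₍₂₎ = s_R(π_R(a))` -/
  antipode_left : ∀ a,
    BalTensor.lift (AddMonoidHom.mul.comp S.toAddMonoidHom)
      (fun l a' b' => by
        change S (left.t (.op l) * a') * b' = S a' * (left.s l * b')
        have h := S_left l 1 a'
        rw [MulOpposite.op_one, map_one, map_one, mul_one, one_mul] at h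
        rw [h, mul_assoc]) (left.γ a) = right.s (right.π a)
  /-- `a⁽¹⁾ S(a⁽²⁾) = s_L(π_L(a))` -/
  antipode_right : ∀ a,
    BalTensor.lift (AddMonoidHom.mul.compl₂ S.toAddMonoidHom)
      (fun r a' b' => by
        change (a' * right.s r) * S b' = a' * S (b' * right.t (.op r))
        have h := S_right r 1 b'
        rw [MulOpposite.op_one, map_one, map_one, mul_one, one_mul] at h
        rw [h, mul_assoc]) (right.γ a) = left.s (left.π a)

/-- A homomorphism `(Φ, φ)` of left bialgebroids. -/
structure LeftBialgebroid.IsHom {A L A' L' : Type*} [Ring A] [Ring L] [Ring A'] [Ring L']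
    (H : LeftBialgebroid A L) (H' : LeftBialgebroid A' L') (Φ : A →+* A') (φ : L →+* L') :
    Prop where
  s : ∀ l, H'.s (φ l) = Φ (H.s l)
  t : ∀ l, H'.t (.op (φ l)) = Φ (H.t (.op l))
  π : ∀ a, H'.π (Φ a) = φ (H.π a)
  /-- `γ'(Φ(a)) = Φ(a₍₁₎) ⊗ Φ(a₍₂₎)` -/
  γ : ∀ a, H'.γ (Φ a) =
    BalTensor.mapBase φ Φ.toAddMonoidHom Φ.toAddMonoidHom
      (fun l a' => by
        change Φ (H.t (.op l) * a') = H'.t (.op (φ l)) * Φ a'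
        rw [map_mul, t])
      (fun l a' => by
        change Φ (H.s l * a') = H'.s (φ l) * Φ a'
        rw [map_mul, s]) (H.γ a)

namespace HopfAlgebroid

variable {A L R : Type*} [Ring A] [Ring L] [Ring R]

/-- A strict isomorphism of Hopf algebroids: a homomorphism of the left bialgebroids with bijective
components that commutes with the antipodes. -/
structure IsStrictIso {A' L' R' : Type*} [Ring A'] [Ring L'] [Ring R']
    (H : HopfAlgebroid A L R) (H' : HopfAlgebroid A' L' R') (Φ : A →+* A') (φ : L →+* L') :
    Prop where
  isHom : H.left.IsHom H'.left Φ φ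
  bijective_total : Function.Bijective Φ
  bijective_base : Function.Bijective φ
  strict : ∀ a, Φ (H.S a) = H'.S (Φ a)

variable (H : HopfAlgebroid A L R)

/-- Left integrals: `a ℓ = s_L(π_L(a)) ℓ` for all `a`. -/
def IsLeftIntegral (ℓ : A) : Prop := ∀ a, a * ℓ = H.left.s (H.left.π a) * ℓ

/-- Right integrals: `ℓ a = ℓ s_R(π_R(a))` for all `a`. -/
def IsRightIntegral (ℓ : A) : Prop := ∀ a, ℓ * a = ℓ * H.right.s (H.right.π a)

/-- Two-sided non-degenerate integrals: the maps `φ ↦ φ ⇀ ℓ` from `𝒜^*` to `A` and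
`φ ↦ φ ⇁ ℓ` from `^*𝒜` to `A` are bijective. -/
structure IsNondegenerateIntegral (ℓ : A) : Prop where
  left_integral : H.IsLeftIntegral ℓ
  right_integral : H.IsRightIntegral ℓ
  bijective_act : Function.Bijective fun φ : H.right.Dual => φ.act ℓ
  bijective_coAct : Function.Bijective fun φ : H.right.coDual => H.right.coAct φ ℓ

variable {H}

/-- The bijection `i_R : 𝒜^* → A`, `φ ↦ φ ⇀ i`. -/
noncomputable def IsNondegenerateIntegral.iR {i : A} (hi : H.IsNondegenerateIntegral i) :
    H.right.Dual ≃ A :=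
  Equiv.ofBijective _ hi.bijective_act

/-- The element `i_R⁻¹(1)` of `𝒜^*`. -/
noncomputable def IsNondegenerateIntegral.dualIntegral {i : A}
    (hi : H.IsNondegenerateIntegral i) : H.right.Dual :=
  hi.iR.symm 1

/-- `D` is the dual Hopf algebroid `𝒜^*_i` on the ring `𝒜^*`: its structure maps are the following
ones, in which the coproduct `γ_R(i) = i⁽¹⁾ ⊗ i⁽²⁾` may be represented by any sum `∑ⱼ uⱼ ⊗ vⱼ`. -/
structure IsDual {i : A} (hi : H.IsNondegenerateIntegral i)
    (D : HopfAlgebroid H.right.Dual R L) : Prop where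
  left_s : ∀ r a, D.left.s r a = r * H.right.π a
  left_t : ∀ r a, D.left.t (.op r) a = H.right.π (H.right.s r * a)
  /-- `γ_L^*(φ) = φ ↼ i⁽¹⁾ ⊗ i_R⁻¹(i⁽²⁾)` -/
  left_γ : ∀ (n : ℕ) (u v : Fin n → A), H.right.γ i = ∑ j, BalTensor.tmul _ _ (u j) (v j) →
    ∀ φ, D.left.γ φ = ∑ j, BalTensor.tmul _ _ (φ.precomp (u j)) (hi.iR.symm (v j))
  left_π : ∀ φ : H.right.Dual, D.left.π φ = φ 1
  right_s : ∀ l a, D.right.s l a = H.right.π (H.left.s l * a)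
  right_t : ∀ l a, D.right.t (.op l) a = hi.dualIntegral (H.S (i * H.left.t (.op l)) * a)
  /-- `γ_R^*(φ) = φ ↼ S²(i⁽²⁾) ⊗ i_R⁻¹(i⁽¹⁾)` -/
  right_γ : ∀ (n : ℕ) (u v : Fin n → A), H.right.γ i = ∑ j, BalTensor.tmul _ _ (u j) (v j) →
    ∀ φ, D.right.γ φ =
      ∑ j, BalTensor.tmul _ _ (φ.precomp (H.S (H.S (v j)))) (hi.iR.symm (u j))
  right_π : ∀ φ : H.right.Dual,
    D.right.π φ = H.left.π (H.right.s ((hi.dualIntegral * φ) i))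
  antipode : ∀ φ, D.S φ = hi.iR.symm (H.S (hi.iR φ))

end HopfAlgebroid

/-! ## Depth 2 Frobenius 1-morphisms -/

universe w v u

/-- A bicategory enriched over abelian groups: the hom-categories are preadditive and horizontal
composition is additive in both arguments. -/
class PreadditiveBicategory (C : Type u) [Bicategory.{w, v} C]
    [∀ a b : C, Preadditive (a ⟶ b)] : Prop where
  whiskerLeft_add : ∀ {a b c : C} (f : a ⟶ b) {g h : b ⟶ c} (x y : g ⟶ h),
    f ◁ (x + y) = f ◁ x + f ◁ y
  add_whiskerRight : ∀ {a b c : C} {f g : a ⟶ b} (x y : f ⟶ g) (h : b ⟶ c),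
    (x + y) ▷ h = x ▷ h + y ▷ h

/-- Frobenius data for a 1-morphism `ι`: a two-sided dual `ῑ` together with the evaluation and
coevaluation 2-morphisms. Horizontal composition `f × g` is written `f ≫ g`. -/
structure FrobeniusData {C : Type u} [Bicategory.{w, v} C] {X Y : C} (ι : X ⟶ Y) where
  /-- the dual 1-morphism `ῑ` -/
  bar : Y ⟶ X
  adjL : Bicategory.Adjunction ι bar
  adjR : Bicategory.Adjunction bar ι

namespace FrobeniusData

section General

variable {C : Type u} [Bicategory.{w, v} C] {X Y : C} {ι : X ⟶ Y} (F : FrobeniusData ι)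

/-- `ev_L : ῑ × ι → 1` -/
abbrev evL : F.bar ≫ ι ⟶ 𝟙 Y := F.adjL.counit
/-- `coev_L : 1 → ι × ῑ` -/
abbrev coevL : 𝟙 X ⟶ ι ≫ F.bar := F.adjL.unit
/-- `ev_R : ι × ῑ → 1` -/
abbrev evR : ι ≫ F.bar ⟶ 𝟙 X := F.adjR.counit
/-- `coev_R : 1 → ῑ × ι` -/
abbrev coevR : 𝟙 Y ⟶ F.bar ≫ ι := F.adjR.unit

/-- `A = End(ι × ῑ)`, whose product is `a * b = a ∘ b` -/
abbrev A : Type w := End (ι ≫ F.bar)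
/-- `B = End(ῑ × ι)` -/
abbrev B : Type w := End (F.bar ≫ ι)
/-- `L = End(ι)` -/
abbrev L (_F : FrobeniusData ι) : Type w := End ι
/-- `R = End(ῑ)` -/
abbrev R : Type w := End F.bar

/-- The convolution product on `A`: the two factors are put side by side and the two inner legs
are closed by `coev_R` and `ev_L`. -/
def convA (a₁ a₂ : F.A) : F.A :=
  End.of ((ρ_ ι).inv ▷ F.bar ≫ (ι ◁ F.coevR) ▷ F.bar ≫ (α_ ι F.bar ι).inv ▷ F.bar ≫
    (α_ (ι ≫ F.bar) ι F.bar).hom ≫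
    a₁.asHom ▷ (ι ≫ F.bar) ≫ (ι ≫ F.bar) ◁ a₂.asHom ≫
    (α_ (ι ≫ F.bar) ι F.bar).inv ≫
    (α_ ι F.bar ι).hom ▷ F.bar ≫ (ι ◁ F.evL) ▷ F.bar ≫ (ρ_ ι).hom ▷ F.bar)

/-- The convolution product on `B`: the two factors are put side by side and the two inner legs
are closed by `coev_L` and `ev_R`. -/
def convB (b₁ b₂ : F.B) : F.B :=
  End.of (F.bar ◁ (λ_ ι).inv ≫ F.bar ◁ (F.coevL ▷ ι) ≫ F.bar ◁ (α_ ι F.bar ι).hom ≫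
    (α_ F.bar ι (F.bar ≫ ι)).inv ≫
    b₁.asHom ▷ (F.bar ≫ ι) ≫ (F.bar ≫ ι) ◁ b₂.asHom ≫
    (α_ F.bar ι (F.bar ≫ ι)).hom ≫
    F.bar ◁ (α_ ι F.bar ι).inv ≫ F.bar ◁ (F.evR ▷ ι) ≫ F.bar ◁ (λ_ ι).hom)

/-- The unit `i_A = coev_L ∘ ev_R` of the convolution product on `A`. -/
def iA : F.A := End.of (F.evR ≫ F.coevL)

/-- The Fourier transformation `ℱ : A → B`. -/
def fourier (a : F.A) : F.B :=
  End.of ((λ_ (F.bar ≫ ι)).inv ≫ F.coevR ▷ (F.bar ≫ ι) ≫ (α_ (F.bar ≫ ι) F.bar ι).inv ≫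
    (α_ F.bar ι F.bar).hom ▷ ι ≫ (F.bar ◁ a.asHom) ▷ ι ≫ (α_ F.bar ι F.bar).inv ▷ ι ≫
    (α_ (F.bar ≫ ι) F.bar ι).hom ≫ (F.bar ≫ ι) ◁ F.evL ≫ (ρ_ (F.bar ≫ ι)).hom)

/-- The second Fourier transformation `ℱ̇ : A → B`. -/
def fourierDot (a : F.A) : F.B :=
  End.of ((ρ_ (F.bar ≫ ι)).inv ≫ (F.bar ≫ ι) ◁ F.coevR ≫ (α_ F.bar ι (F.bar ≫ ι)).hom ≫
    F.bar ◁ (α_ ι F.bar ι).inv ≫ F.bar ◁ (a.asHom ▷ ι) ≫ F.bar ◁ (α_ ι F.bar ι).hom ≫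
    (α_ F.bar ι (F.bar ≫ ι)).inv ≫ F.evL ▷ (F.bar ≫ ι) ≫ (λ_ (F.bar ≫ ι)).hom)

/-- The inverse `ℱ⁻¹ : B → A`. -/
def fourierInv (b : F.B) : F.A :=
  End.of ((ρ_ (ι ≫ F.bar)).inv ≫ (ι ≫ F.bar) ◁ F.coevL ≫ (α_ ι F.bar (ι ≫ F.bar)).hom ≫
    ι ◁ (α_ F.bar ι F.bar).inv ≫ ι ◁ (b.asHom ▷ F.bar) ≫ ι ◁ (α_ F.bar ι F.bar).hom ≫
    (α_ ι F.bar (ι ≫ F.bar)).inv ≫ F.evR ▷ (ι ≫ F.bar) ≫ (λ_ (ι ≫ F.bar)).hom)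

/-- The inverse `ℱ̇⁻¹ : B → A`. -/
def fourierDotInv (b : F.B) : F.A :=
  End.of ((λ_ (ι ≫ F.bar)).inv ≫ F.coevL ▷ (ι ≫ F.bar) ≫ (α_ (ι ≫ F.bar) ι F.bar).inv ≫
    (α_ ι F.bar ι).hom ▷ F.bar ≫ (ι ◁ b.asHom) ▷ F.bar ≫ (α_ ι F.bar ι).inv ▷ F.bar ≫
    (α_ (ι ≫ F.bar) ι F.bar).hom ≫ (ι ≫ F.bar) ◁ F.evR ≫ (ρ_ (ι ≫ F.bar)).hom)

/-- `S_A = ℱ̇⁻¹ ∘ ℱ` -/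
def SA (a : F.A) : F.A := F.fourierDotInv (F.fourier a)

/-- `S_A⁻¹ = ℱ⁻¹ ∘ ℱ̇` -/
def SAInv (a : F.A) : F.A := F.fourierInv (F.fourierDot a)

/-- `S_B = ℱ ∘ ℱ̇⁻¹` -/
def SB (b : F.B) : F.B := F.fourier (F.fourierDotInv b)

/-- `μ : L → Rᵒᵖ` -/
def mu (l : F.L) : F.R :=
  End.of ((ρ_ F.bar).inv ≫ F.bar ◁ F.coevL ≫ (α_ F.bar ι F.bar).inv ≫
    (F.bar ◁ l.asHom) ▷ F.bar ≫ F.evL ▷ F.bar ≫ (λ_ F.bar).hom)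

/-- `ν : L → Rᵒᵖ` -/
def nu (l : F.L) : F.R :=
  End.of ((λ_ F.bar).inv ≫ F.coevR ▷ F.bar ≫ (α_ F.bar ι F.bar).hom ≫
    F.bar ◁ (l.asHom ▷ F.bar) ≫ F.bar ◁ F.evR ≫ (ρ_ F.bar).hom)

/-- `ν⁻¹ : R → Lᵒᵖ`; see `nuInv_nu` and `nu_nuInv`. -/
def nuInv (r : F.R) : F.L :=
  End.of ((ρ_ ι).inv ≫ ι ◁ F.coevR ≫ ι ◁ (r.asHom ▷ ι) ≫ (α_ ι F.bar ι).inv ≫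
    F.evR ▷ ι ≫ (λ_ ι).hom)

theorem nu_eq (l : F.L) : F.nu l = (conjugateEquiv F.adjR F.adjR).symm l :=
  (conjugateEquiv_symm_apply' F.adjR F.adjR l).symm

theorem nuInv_eq (r : F.R) : F.nuInv r = conjugateEquiv F.adjR F.adjR r :=
  (conjugateEquiv_apply' F.adjR F.adjR r).symm

theorem nuInv_nu (l : F.L) : F.nuInv (F.nu l) = l := by
  rw [nuInv_eq, nu_eq]
  exact Equiv.apply_symm_apply _ _

theorem nu_nuInv (r : F.R) : F.nu (F.nuInv r) = r := by
  rw [nuInv_eq, nu_eq]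
  exact Equiv.symm_apply_apply _ _

/-- The Frobenius map `φ_L : A → L`, the partial trace over the right leg. -/
def phiL (a : F.A) : F.L :=
  End.of ((ρ_ ι).inv ≫ ι ◁ F.coevR ≫ (α_ ι F.bar ι).inv ≫ a.asHom ▷ ι ≫ (α_ ι F.bar ι).hom ≫
    ι ◁ F.evL ≫ (ρ_ ι).hom)

end General

section Additive

variable {C : Type u} [Bicategory.{w, v} C] [∀ a b : C, Preadditive (a ⟶ b)]
  {X Y : C} {ι : X ⟶ Y} (F : FrobeniusData ι)

/-- The depth 2 condition: `(ι × ῑ) × ι` is a direct summand of a finite direct sum of copies of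
`ι`, and `(ῑ × ι) × ῑ` is a direct summand of a finite direct sum of copies of `ῑ`. -/
def IsD2 [∀ a b : C, HasFiniteBiproducts (a ⟶ b)] : Prop :=
  (∃ n : ℕ, Nonempty (Retract ((ι ≫ F.bar) ≫ ι) (⨁ fun _ : Fin n => ι))) ∧
    ∃ n : ℕ, Nonempty (Retract ((F.bar ≫ ι) ≫ F.bar) (⨁ fun _ : Fin n => F.bar))

/-- The families `y`, `x` form a D2 quasi-basis `∑ᵢ yᵢ ⊗ xᵢ`. -/
def IsQuasiBasis {n : ℕ} (y x : Fin n → F.A) : Prop :=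
  ∑ i, ((x i).asHom ▷ ι ≫ (α_ ι F.bar ι).hom ≫ ι ◁ F.evL ≫ ι ◁ F.coevR ≫
    (α_ ι F.bar ι).inv ≫ (y i).asHom ▷ ι) = 𝟙 ((ι ≫ F.bar) ≫ ι)

/-- `H` is the Hopf algebroid `𝒜` on `A`: its structure maps are the following ones. -/
structure IsHopfA (H : HopfAlgebroid F.A F.L F.R) : Prop where
  left_s : ∀ l, H.left.s l = l.asHom ▷ F.bar
  left_t : ∀ l, H.left.t (.op l) = ι ◁ (F.mu l).asHom
  left_γ : ∀ (n : ℕ) (y x : Fin n → F.A), F.IsQuasiBasis y x → ∀ a,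
    H.left.γ a = ∑ i, BalTensor.tmul _ _ (F.convA a (F.SAInv (y i))) (x i) ∧
    H.left.γ a = ∑ i, BalTensor.tmul _ _ (F.SAInv (y i)) (F.convA (x i) a)
  left_π : ∀ a, H.left.π a = F.phiL (a * F.iA)
  right_s : ∀ r, H.right.s r = ι ◁ r.asHom
  right_t : ∀ r, H.right.t (.op r) = (F.nuInv r).asHom ▷ F.bar
  right_γ : ∀ (n : ℕ) (y x : Fin n → F.A), F.IsQuasiBasis y x → ∀ a,
    H.right.γ a = ∑ i, BalTensor.tmul _ _ (F.convA a (F.SA (x i))) (y i) ∧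
    H.right.γ a = ∑ i, BalTensor.tmul _ _ (F.SA (x i)) (F.convA (y i) a)
  right_π : ∀ a, H.right.π a = F.nu (F.phiL (F.SAInv a * F.iA))
  antipode : ∀ a, H.S a = F.SA a

/-- `H` is the Hopf algebroid `ℬ` on `B`: its structure maps are the following ones. -/
structure IsHopfB (H : HopfAlgebroid F.B F.R F.L) : Prop where
  left_s : ∀ r, H.left.s r = r.asHom ▷ ι
  left_t : ∀ r, H.left.t (.op r) = F.bar ◁ (F.nuInv r).asHom
  left_γ : ∀ (n : ℕ) (y x : Fin n → F.A), F.IsQuasiBasis y x → ∀ b,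
    H.left.γ b = ∑ i, BalTensor.tmul _ _ (F.convB b (F.fourier (x i))) (F.fourier (y i)) ∧
    H.left.γ b = ∑ i, BalTensor.tmul _ _ (F.fourier (x i)) (F.convB (F.fourier (y i)) b)
  left_π : ∀ b, H.left.π b = F.nu (F.phiL (F.fourierInv b))
  right_s : ∀ l, H.right.s l = F.bar ◁ l.asHom
  right_t : ∀ l, H.right.t (.op l) = (F.mu l).asHom ▷ ι
  right_γ : ∀ (n : ℕ) (y x : Fin n → F.A), F.IsQuasiBasis y x → ∀ b,
    H.right.γ b =
      ∑ i, BalTensor.tmul _ _ (F.convB b (F.fourierDot (y i))) (F.fourierDot (x i)) ∧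
    H.right.γ b =
      ∑ i, BalTensor.tmul _ _ (F.fourierDot (y i)) (F.convB (F.fourierDot (x i)) b)
  right_π : ∀ b, H.right.π b = F.phiL (F.fourierDotInv b)
  antipode : ∀ b, H.S b = F.SB b

end Additive

end FrobeniusData

/-! The ring `A` has two products, composition with unit `1` and convolution `⋆` with unit `iA`. A
quarter turn of pictures, `ℱ`, exchanges them with the two products of `B` (`fourier_convA`,
`convB_fourier`). The antipode of `A` is a half turn and therefore reverses both products (`SA_mul`,
`SA_convA`). Depth 2 enters only through the existence of quasi-bases. A quasi-basis resolves the
identity of `(ι × ῑ) × ι`; inserting this resolution in the middle of a picture gives the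
distributive law `(p q) ⋆ (d c) = ∑ (p yⱼ ⋆ d)(xⱼ q ⋆ c)` (`IsQuasiBasis.convA_mul`).

From there on no pictures are needed. `FrobeniusDoubleRing` collects the identities, and the Hopf
algebroid is a formal consequence. Substituting units in the distributive law shows that a
quasi-basis is a dual basis for `φ`, and the coproduct formulas hold for every dual basis
(`sum_leftTmul_eq`, `sum_rightTmul_eq`), hence do not depend on the choice. The map `c ⊗ d ↦ S(c)((d
p) ⋆ e)` sends the left coproduct of `a` to `p ⋆ (S(a) e)`; with `e = 1` and varying `p` these maps
separate tensors, so multiplicativity of the coproduct becomes an identity in `A`. The right side is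
the mirror image.

For duality, the functional `c ↦ ν φ(S⁻¹(c) a)` acts on `A` as convolution by `a`
(`functional_act`). Since `a ⋆ i = a`, forming this functional inverts `i_R`, and the dual product
corresponds to convolution. Hence the dual ring is `(A, ⋆)`, which `ℱ` identifies with `B`; this is
the map `α*`.

The Hopf algebroid `ℬ` is the same construction applied to `ῑ`. Its formulas in terms of a
quasi-basis of `ι` hold because `ℱ` turns dual bases into dual bases (`FourierPair.isDualBasis`).
The structure on the dual is transported from `ℬ` along `α*`, so strictness of the isomorphism is
automatic; the content is that the transported maps are the prescribed ones (`FourierPair.isDual`).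
-/

/-! ## Components of 2-morphisms

A 2-morphism acts by horizontal composition on the 1-morphisms into its source. -/

namespace BicategoryComponents

variable {C : Type u} [Bicategory.{w, v} C]

/-- The component at `U` of an endomorphism of `f ≫ g`. -/
def endComp {X Y Z : C} {f : X ⟶ Y} {g : Y ⟶ Z} (a : f ≫ g ⟶ f ≫ g) {W : C} (U : W ⟶ X) :
    (U ≫ f) ≫ g ⟶ (U ≫ f) ≫ g :=
  (α_ U f g).hom ≫ U ◁ a ≫ (α_ U f g).inv

/-- The component at `U` of the unit of an adjunction. -/
def unitComp {X Y : C} {f : X ⟶ Y} {g : Y ⟶ X} (adj : f ⊣ g) {W : C} (U : W ⟶ X) :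
    U ⟶ (U ≫ f) ≫ g :=
  (ρ_ U).inv ≫ U ◁ adj.unit ≫ (α_ U f g).inv

/-- The component at `V` of the counit of an adjunction. -/
def counitComp {X Y : C} {f : X ⟶ Y} {g : Y ⟶ X} (adj : f ⊣ g) {W : C} (V : W ⟶ Y) :
    (V ≫ g) ≫ f ⟶ V :=
  (α_ V g f).hom ≫ V ◁ adj.counit ≫ (ρ_ V).hom

section

variable {X Y Z W : C} {f : X ⟶ Y} {g : Y ⟶ Z}

/-- This is the interchange law. With all composites bracketed to the left, morphisms of `U` are
whiskered on the right only, so the rule contains no associator. -/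
theorem endComp_naturality (a : f ≫ g ⟶ f ≫ g) {U U' : W ⟶ X} (h : U ⟶ U') :
    (h ▷ f) ▷ g ≫ endComp a U' = endComp a U ≫ (h ▷ f) ▷ g := by
  simp only [endComp, associator_naturality_left_assoc, ← whisker_exchange_assoc,
    associator_inv_naturality_left, Category.assoc]

theorem endComp_comp (a b : f ≫ g ⟶ f ≫ g) (U : W ⟶ X) :
    endComp (a ≫ b) U = endComp a U ≫ endComp b U := by
  simp [endComp]

theorem endComp_id (U : W ⟶ X) : endComp (𝟙 (f ≫ g)) U = 𝟙 _ := by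
  simp [endComp]

theorem endComp_whiskerRight (l : f ⟶ f) (U : W ⟶ X) :
    endComp (l ▷ g) U = (U ◁ l) ▷ g := by
  simp [endComp]

theorem endComp_whiskerLeft (r : g ⟶ g) (U : W ⟶ X) :
    endComp (f ◁ r) U = (U ≫ f) ◁ r := by
  simp [endComp]

/-- Whiskering with an identity 1-morphism is faithful, so identities of 2-morphisms may be checked
on components. -/
theorem endComp_injective {a b : f ≫ g ⟶ f ≫ g} (h : endComp a (𝟙 X) = endComp b (𝟙 X)) :
    a = b := by
  simp only [endComp, cancel_epi, cancel_mono, ← Category.assoc] at h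
  exact (whiskerLeft_iff a b).1 h

end

section

variable {X Y W : C} {f : X ⟶ Y} {g : Y ⟶ X} (adj : f ⊣ g)

theorem unitComp_naturality {U U' : W ⟶ X} (h : U ⟶ U') :
    h ≫ unitComp adj U' = unitComp adj U ≫ (h ▷ f) ▷ g := by
  rw [unitComp, unitComp, Category.assoc, Category.assoc, ← associator_inv_naturality_left,
    whisker_exchange_assoc, rightUnitor_inv_naturality_assoc]

theorem counitComp_naturality {V V' : W ⟶ Y} (h : V ⟶ V') :
    (h ▷ g) ▷ f ≫ counitComp adj V' = counitComp adj V ≫ h := by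
  simp only [counitComp, associator_naturality_left_assoc, Category.assoc]
  rw [← whisker_exchange_assoc, rightUnitor_naturality]

/-- The left triangle identity whiskered with `U`; the primed version below comes from the right
triangle identity. -/
theorem unitComp_counitComp (U : W ⟶ X) :
    unitComp adj U ▷ f ≫ counitComp adj (U ≫ f) = 𝟙 _ := by
  have h := congrArg (fun z => (ρ_ U).inv ▷ f ≫ (α_ _ _ _).hom ≫ U ◁ z ≫ U ◁ (ρ_ f).hom)
    adj.left_triangle
  refine Eq.trans ?_ (h.trans ?_)
  · simp only [unitComp, counitComp, leftZigzag]; bicategory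
  · bicategory

theorem unitComp_counitComp' (V : W ⟶ Y) :
    unitComp adj (V ≫ g) ≫ counitComp adj V ▷ g = 𝟙 _ := by
  have h := congrArg (fun z => V ◁ (ρ_ g).inv ≫ V ◁ z ≫ (V ◁ (λ_ g).hom)) adj.right_triangle
  refine Eq.trans ?_ (h.trans ?_)
  · simp only [unitComp, counitComp, rightZigzag]; bicategory
  · bicategory

end

end BicategoryComponents

open BicategoryComponents

/-! ### Components of the structure maps of a Frobenius 1-morphism -/

namespace FrobeniusData

variable {C : Type u} [Bicategory.{w, v} C] {X Y : C} {ι : X ⟶ Y}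

/-- The Frobenius data of `ῑ` with the dual `ι`. -/
abbrev flip (F : FrobeniusData ι) : FrobeniusData F.bar := ⟨ι, F.adjR, F.adjL⟩

variable (F : FrobeniusData ι) {W : C}

/-- The two sides differ only by coherence isomorphisms. The same is true of all component formulas
up to `whiskerLeft_nuInv`; later computations use these formulas and never the definitions with
their associators. -/
theorem endComp_convA (a b : F.A) (U : W ⟶ X) :
    endComp (F.convA a b) U =
      unitComp F.adjR (U ≫ ι) ▷ F.bar ≫ (endComp a U ▷ ι) ▷ F.bar ≫
        endComp b ((U ≫ ι) ≫ F.bar) ≫ counitComp F.adjL (U ≫ ι) ▷ F.bar := by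
  -- Reintroducing the variables at their hom types makes them plain 2-morphisms, the form in which
  -- the coherence tactic is applied.
  revert a b
  intro (a : ι ≫ F.bar ⟶ ι ≫ F.bar) (b : ι ≫ F.bar ⟶ ι ≫ F.bar)
  simp only [End.of, End.asHom, endComp, unitComp, counitComp, convA]
  bicategory

theorem endComp_convB (a b : F.B) (U : W ⟶ Y) :
    endComp (F.convB a b) U =
      unitComp F.adjL (U ≫ F.bar) ▷ ι ≫ (endComp a U ▷ F.bar) ▷ ι ≫
        endComp b ((U ≫ F.bar) ≫ ι) ≫ counitComp F.adjR (U ≫ F.bar) ▷ ι := by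
  revert a b
  intro (a : F.bar ≫ ι ⟶ F.bar ≫ ι) (b : F.bar ≫ ι ⟶ F.bar ≫ ι)
  simp only [End.of, End.asHom, endComp, unitComp, counitComp, convB]
  bicategory

theorem endComp_iA (U : W ⟶ X) :
    endComp F.iA U = counitComp F.adjR U ≫ unitComp F.adjL U := by
  simp only [endComp, unitComp, counitComp, iA]
  bicategory

theorem endComp_fourier (a : F.A) (V : W ⟶ Y) :
    endComp (F.fourier a) V = (unitComp F.adjR V ▷ F.bar) ▷ ι ≫ endComp a (V ≫ F.bar) ▷ ι ≫
      counitComp F.adjL ((V ≫ F.bar) ≫ ι) := by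
  revert a
  intro (a : ι ≫ F.bar ⟶ ι ≫ F.bar)
  simp only [End.of, End.asHom, endComp, unitComp, counitComp, fourier]
  bicategory

theorem endComp_fourierDot (a : F.A) (V : W ⟶ Y) :
    endComp (F.fourierDot a) V = unitComp F.adjR ((V ≫ F.bar) ≫ ι) ≫ endComp a (V ≫ F.bar) ▷ ι ≫
      (counitComp F.adjL V ▷ F.bar) ▷ ι := by
  revert a
  intro (a : ι ≫ F.bar ⟶ ι ≫ F.bar)
  simp only [End.of, End.asHom, endComp, unitComp, counitComp, fourierDot]
  bicategory

theorem endComp_fourierInv (b : F.B) (U : W ⟶ X) :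
    endComp (F.fourierInv b) U = unitComp F.adjL ((U ≫ ι) ≫ F.bar) ≫
      endComp b (U ≫ ι) ▷ F.bar ≫ (counitComp F.adjR U ▷ ι) ▷ F.bar := by
  revert b
  intro (b : F.bar ≫ ι ⟶ F.bar ≫ ι)
  simp only [End.of, End.asHom, endComp, unitComp, counitComp, fourierInv]
  bicategory

theorem endComp_fourierDotInv (b : F.B) (U : W ⟶ X) :
    endComp (F.fourierDotInv b) U = (unitComp F.adjL U ▷ ι) ▷ F.bar ≫
      endComp b (U ≫ ι) ▷ F.bar ≫ counitComp F.adjR ((U ≫ ι) ≫ F.bar) := by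
  revert b
  intro (b : F.bar ≫ ι ⟶ F.bar ≫ ι)
  simp only [End.of, End.asHom, endComp, unitComp, counitComp, fourierDotInv]
  bicategory

theorem whiskerLeft_phiL (a : F.A) (U : W ⟶ X) :
    U ◁ F.phiL a = unitComp F.adjR (U ≫ ι) ≫ endComp a U ▷ ι ≫ counitComp F.adjL (U ≫ ι) := by
  revert a
  intro (a : ι ≫ F.bar ⟶ ι ≫ F.bar)
  simp only [End.of, End.asHom, endComp, unitComp, counitComp, phiL]
  bicategory

theorem whiskerLeft_mu (l : F.L) (V : W ⟶ Y) :
    V ◁ F.mu l = unitComp F.adjL (V ≫ F.bar) ≫ ((V ≫ F.bar) ◁ l.asHom) ▷ F.bar ≫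
      counitComp F.adjL V ▷ F.bar := by
  revert l
  intro (l : ι ⟶ ι)
  simp only [End.of, End.asHom, unitComp, counitComp, mu]
  bicategory

theorem whiskerLeft_nu (l : F.L) (V : W ⟶ Y) :
    V ◁ F.nu l = unitComp F.adjR V ▷ F.bar ≫ ((V ≫ F.bar) ◁ l.asHom) ▷ F.bar ≫
      counitComp F.adjR (V ≫ F.bar) := by
  revert l
  intro (l : ι ⟶ ι)
  simp only [End.of, End.asHom, unitComp, counitComp, nu]
  bicategory

theorem whiskerLeft_nuInv (r : F.R) (U : W ⟶ X) :
    U ◁ F.nuInv r = unitComp F.adjR (U ≫ ι) ≫ ((U ≫ ι) ◁ r.asHom) ▷ ι ≫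
      counitComp F.adjR U ▷ ι := by
  revert r
  intro (r : F.bar ⟶ F.bar)
  simp only [End.of, End.asHom, unitComp, counitComp, nuInv]
  bicategory

end FrobeniusData

/-! ### Naturality and triangle identities as rewrite rules inside longer composites -/

namespace BicategoryComponents

variable {C : Type u} [Bicategory.{w, v} C] {X Y Z W : C}

theorem endComp_naturality_assoc {f : X ⟶ Y} {g : Y ⟶ Z} (a : f ≫ g ⟶ f ≫ g) {U U' : W ⟶ X}
    (h : U ⟶ U') {Q : W ⟶ Z} (k : (U' ≫ f) ≫ g ⟶ Q) :
    (h ▷ f) ▷ g ≫ endComp a U' ≫ k = endComp a U ≫ (h ▷ f) ▷ g ≫ k := by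
  rw [← Category.assoc, endComp_naturality, Category.assoc]

theorem endComp_naturality_whisker_assoc {Z' : C} {f : X ⟶ Y} {g : Y ⟶ Z} {p : Z ⟶ Z'}
    (a : f ≫ g ⟶ f ≫ g) {U U' : W ⟶ X}
    (h : U ⟶ U') {Q : W ⟶ Z'} (k : ((U' ≫ f) ≫ g) ≫ p ⟶ Q) :
    ((h ▷ f) ▷ g) ▷ p ≫ endComp a U' ▷ p ≫ k = endComp a U ▷ p ≫ ((h ▷ f) ▷ g) ▷ p ≫ k := by
  rw [← comp_whiskerRight_assoc, endComp_naturality, comp_whiskerRight_assoc]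

variable {f : X ⟶ Y} {g : Y ⟶ X} (adj : f ⊣ g)

theorem unitComp_naturality_assoc {U U' Q : W ⟶ X} (h : U ⟶ U') (k : (U' ≫ f) ≫ g ⟶ Q) :
    h ≫ unitComp adj U' ≫ k = unitComp adj U ≫ (h ▷ f) ▷ g ≫ k := by
  rw [← Category.assoc, unitComp_naturality, Category.assoc]

theorem counitComp_naturality_assoc {V V' Q : W ⟶ Y} (h : V ⟶ V') (k : V' ⟶ Q) :
    (h ▷ g) ▷ f ≫ counitComp adj V' ≫ k = counitComp adj V ≫ h ≫ k := by
  rw [← Category.assoc, counitComp_naturality, Category.assoc]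

theorem unitComp_counitComp_assoc (U : W ⟶ X) {Q : W ⟶ Y} (k : U ≫ f ⟶ Q) :
    unitComp adj U ▷ f ≫ counitComp adj (U ≫ f) ≫ k = k := by
  rw [← Category.assoc, unitComp_counitComp, Category.id_comp]

theorem unitComp_counitComp'_assoc (V : W ⟶ Y) {Q : W ⟶ X} (k : V ≫ g ⟶ Q) :
    unitComp adj (V ≫ g) ≫ counitComp adj V ▷ g ≫ k = k := by
  rw [← Category.assoc, unitComp_counitComp', Category.id_comp]

end BicategoryComponents

/-! ### The two products, the Fourier transformations and the antipode -/

namespace FrobeniusData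

section General
variable {C : Type u} [Bicategory.{w, v} C] {X Y : C} {ι : X ⟶ Y}

variable (F : FrobeniusData ι)

theorem ext_endComp {a b : F.A} (h : endComp a (𝟙 X) = endComp b (𝟙 X)) : a = b :=
  endComp_injective h

theorem ext_endComp' {a b : F.B} (h : endComp a (𝟙 Y) = endComp b (𝟙 Y)) : a = b :=
  endComp_injective h

theorem endComp_mul {W : C} {X Y : C} {f : X ⟶ Y} {g : Y ⟶ X} (a b : End (f ≫ g)) (U : W ⟶ X) :
    endComp (a * b) U = endComp b U ≫ endComp a U :=
  endComp_comp b a U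

/-- The definitions bracket differently but have the same components. This lemma and the next ones
let every statement about `B` be read off from one about `A`. -/
theorem flip_convA (a b : F.B) : F.flip.convA a b = F.convB a b :=
  F.ext_endComp' ((F.flip.endComp_convA a b _).trans (F.endComp_convB a b _).symm)

theorem flip_fourier (b : F.B) : F.flip.fourier b = F.fourierDotInv b :=
  F.ext_endComp ((F.flip.endComp_fourier b _).trans (F.endComp_fourierDotInv b _).symm)

theorem flip_fourierDot (b : F.B) : F.flip.fourierDot b = F.fourierInv b :=
  F.ext_endComp ((F.flip.endComp_fourierDot b _).trans (F.endComp_fourierInv b _).symm)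

theorem flip_fourierInv (a : F.A) : F.flip.fourierInv a = F.fourierDot a :=
  F.ext_endComp' ((F.flip.endComp_fourierInv a _).trans (F.endComp_fourierDot a _).symm)

theorem flip_fourierDotInv (a : F.A) : F.flip.fourierDotInv a = F.fourier a :=
  F.ext_endComp' ((F.flip.endComp_fourierDotInv a _).trans (F.endComp_fourier a _).symm)

theorem flip_mu (r : F.R) : F.flip.mu r = F.nuInv r :=
  (whiskerLeft_iff _ _).1 ((F.flip.whiskerLeft_mu r (𝟙 X)).trans (F.whiskerLeft_nuInv r _).symm)

theorem flip_nuInv (l : F.L) : F.flip.nuInv l = F.mu l :=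
  (whiskerLeft_iff _ _).1 ((F.flip.whiskerLeft_nuInv l (𝟙 Y)).trans (F.whiskerLeft_mu l _).symm)

/-- A quarter turn makes two boxes standing side by side into two stacked ones. The rewrites slide
the (co)evaluations past the boxes until both pictures agree. -/
theorem fourier_convA (a b : F.A) : F.fourier (F.convA a b) = F.fourier a * F.fourier b := by
  apply F.ext_endComp'
  rw [endComp_mul]
  simp only [endComp_fourier, endComp_convA, comp_whiskerRight, Category.assoc]
  rw [← counitComp_naturality]
  simp only [comp_whiskerRight, Category.assoc]
  rw [← endComp_naturality_whisker_assoc, ← endComp_naturality_whisker_assoc]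
  simp only [← comp_whiskerRight, ← comp_whiskerRight_assoc]
  rw [unitComp_naturality_assoc]
  simp only [comp_whiskerRight, Category.assoc]

/-- The turn in the other direction stacks the boxes in the opposite order. -/
theorem fourierDot_convA (a b : F.A) :
    F.fourierDot (F.convA a b) = F.fourierDot b * F.fourierDot a := by
  apply F.ext_endComp'
  rw [endComp_mul]
  simp only [endComp_fourierDot, endComp_convA, comp_whiskerRight, Category.assoc]
  rw [unitComp_naturality_assoc, unitComp_naturality_assoc, unitComp_naturality_assoc,
    endComp_naturality_whisker_assoc]
  simp only [← comp_whiskerRight]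
  rw [endComp_naturality_assoc, ← comp_whiskerRight, counitComp_naturality]
  simp only [comp_whiskerRight]
  rw [endComp_naturality_whisker_assoc]

theorem fourierInv_fourier (a : F.A) : F.fourierInv (F.fourier a) = a := by
  apply F.ext_endComp
  simp only [endComp_fourierInv, endComp_fourier, comp_whiskerRight, Category.assoc]
  rw [← unitComp_naturality_assoc, ← unitComp_naturality_assoc, unitComp_counitComp'_assoc,
    ← endComp_naturality, ← comp_whiskerRight_assoc, unitComp_counitComp',
    id_whiskerRight, Category.id_comp]

theorem fourier_fourierInv (b : F.B) : F.fourier (F.fourierInv b) = b := by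
  apply F.ext_endComp'
  simp only [endComp_fourierInv, endComp_fourier, comp_whiskerRight, Category.assoc]
  rw [counitComp_naturality, counitComp_naturality_assoc, unitComp_counitComp_assoc,
    endComp_naturality_assoc, ← comp_whiskerRight, unitComp_counitComp,
    id_whiskerRight, Category.comp_id]

theorem fourierDotInv_fourierDot (a : F.A) : F.fourierDotInv (F.fourierDot a) = a := by
  rw [← flip_fourier, ← flip_fourierInv]
  exact F.flip.fourier_fourierInv a

theorem fourierDot_fourierDotInv (b : F.B) : F.fourierDot (F.fourierDotInv b) = b := by
  rw [← flip_fourierInv, ← flip_fourier]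
  exact F.flip.fourierInv_fourier b

theorem fourier_iA : F.fourier F.iA = 1 := by
  apply F.ext_endComp'
  simp only [endComp_fourier, endComp_iA, comp_whiskerRight, Category.assoc]
  rw [unitComp_counitComp, Category.comp_id, ← comp_whiskerRight, unitComp_counitComp,
    id_whiskerRight]
  exact (endComp_id _).symm

theorem fourierInv_convB (a b : F.B) :
    F.fourierInv (F.convB a b) = F.fourierInv b * F.fourierInv a := by
  simp only [← flip_fourierDot, ← flip_convA]
  exact F.flip.fourierDot_convA a b

theorem convB_fourier (a b : F.A) :
    F.convB (F.fourier a) (F.fourier b) = F.fourier (b * a) := by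
  rw [← F.fourier_fourierInv (F.convB _ _), fourierInv_convB, fourierInv_fourier,
    fourierInv_fourier]

theorem fourierDotInv_convB (a b : F.B) :
    F.fourierDotInv (F.convB a b) = F.fourierDotInv a * F.fourierDotInv b := by
  simp only [← flip_fourier, ← flip_convA]
  exact F.flip.fourier_convA a b

theorem SA_SAInv (a : F.A) : F.SA (F.SAInv a) = a := by
  rw [SA, SAInv, fourier_fourierInv, fourierDotInv_fourierDot]

theorem SAInv_SA (a : F.A) : F.SAInv (F.SA a) = a := by
  rw [SA, SAInv, fourierDot_fourierDotInv, fourierInv_fourier]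

theorem fourierDot_SA (a : F.A) : F.fourierDot (F.SA a) = F.fourier a :=
  F.fourierDot_fourierDotInv _

/-- The first quarter turn takes composition to the convolution of `B` and reverses the order; the
second takes that back to composition and keeps the order. -/
theorem SA_mul (a b : F.A) : F.SA (a * b) = F.SA b * F.SA a := by
  rw [SA, ← convB_fourier, fourierDotInv_convB, SA, SA]

theorem SA_convA (a b : F.A) : F.SA (F.convA a b) = F.convA (F.SA b) (F.SA a) := by
  rw [← F.fourierDotInv_fourierDot (F.convA (F.SA b) _), fourierDot_convA, fourierDot_SA,
    fourierDot_SA, ← fourier_convA, SA]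

/-- Convolution is composition in `B` seen through the bijection `ℱ`, so associativity and the unit
laws below are inherited. -/
theorem convA_assoc (a b c : F.A) :
    F.convA (F.convA a b) c = F.convA a (F.convA b c) := by
  rw [← F.fourierInv_fourier (F.convA (F.convA a b) c), fourier_convA, fourier_convA, mul_assoc,
    ← fourier_convA, ← fourier_convA, fourierInv_fourier]

theorem iA_convA (a : F.A) : F.convA F.iA a = a := by
  rw [← F.fourierInv_fourier (F.convA _ _), fourier_convA, fourier_iA, one_mul, fourierInv_fourier]

theorem convA_iA (a : F.A) : F.convA a F.iA = a := by
  rw [← F.fourierInv_fourier (F.convA _ _), fourier_convA, fourier_iA, mul_one, fourierInv_fourier]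

/-- With the identity as second factor, the two strands joined to the right leg of `a` close up into
the partial trace. -/
theorem convA_one (a : F.A) : F.convA a 1 = F.phiL a ▷ F.bar := by
  apply F.ext_endComp
  rw [endComp_whiskerRight, whiskerLeft_phiL, endComp_convA, End.one_def, endComp_id]
  simp only [comp_whiskerRight, Category.id_comp]

theorem whiskerRight_mul_convA (l : F.L) (a b : F.A) :
    (End.of (l.asHom ▷ F.bar)) * F.convA a b = F.convA (End.of (l.asHom ▷ F.bar) * a) b := by
  apply F.ext_endComp
  simp only [endComp_mul, endComp_convA, endComp_whiskerRight, comp_whiskerRight, Category.assoc]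
  rw [← comp_whiskerRight, ← counitComp_naturality, comp_whiskerRight, ← endComp_naturality_assoc]

theorem convA_mul_whiskerRight (l : F.L) (a b : F.A) :
    F.convA a b * End.of (l.asHom ▷ F.bar) = F.convA (a * End.of (l.asHom ▷ F.bar)) b := by
  apply F.ext_endComp
  simp only [endComp_mul, endComp_convA, endComp_whiskerRight, comp_whiskerRight, Category.assoc]
  rw [← comp_whiskerRight_assoc, unitComp_naturality, comp_whiskerRight_assoc]

variable {W : C}

/-- The 2-morphism `μ(l)` is the transpose of `l` with respect to `ev_L`, so a label can slide
around that cap. -/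
theorem whiskerLeft_mu_counitComp (l : F.L) (V : W ⟶ Y) :
    (V ◁ F.mu l) ▷ ι ≫ counitComp F.adjL V = (V ≫ F.bar) ◁ l.asHom ≫ counitComp F.adjL V := by
  rw [whiskerLeft_mu]
  simp only [comp_whiskerRight, Category.assoc]
  rw [counitComp_naturality, counitComp_naturality_assoc, unitComp_counitComp_assoc]

theorem unitComp_whiskerLeft_nu (l : F.L) (V : W ⟶ Y) :
    unitComp F.adjR V ≫ (V ◁ F.nu l) ▷ ι = unitComp F.adjR V ≫ (V ≫ F.bar) ◁ l.asHom := by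
  rw [whiskerLeft_nu]
  simp only [comp_whiskerRight]
  rw [← unitComp_naturality_assoc, ← unitComp_naturality_assoc, unitComp_counitComp',
    Category.comp_id]

/-- The label `μ(l)` on the right leg of the first factor passes through the cap `ev_L` to the left
leg of the second factor. -/
theorem convA_slide (l : F.L) (a b : F.A) :
    F.convA (End.of (ι ◁ (F.mu l).asHom) * a) b = F.convA a (End.of (l.asHom ▷ F.bar) * b) := by
  apply F.ext_endComp
  simp only [endComp_mul, endComp_convA, endComp_whiskerRight, endComp_whiskerLeft,
    comp_whiskerRight, Category.assoc]
  rw [endComp_naturality_assoc]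
  simp only [← comp_whiskerRight]
  rw [whiskerLeft_mu_counitComp]

theorem fourier_whiskerLeft_mu (l : F.L) :
    F.fourier (ι ◁ (F.mu l).asHom) = F.fourierDot (l.asHom ▷ F.bar) := by
  apply F.ext_endComp'
  rw [endComp_fourier, endComp_fourierDot, endComp_whiskerRight, endComp_whiskerLeft,
    ← comp_whiskerRight_assoc, ← whisker_exchange, comp_whiskerRight, Category.assoc,
    counitComp_naturality, ← Category.assoc, whiskerLeft_mu_counitComp,
    ← unitComp_naturality_assoc, ← unitComp_naturality, Category.assoc]

theorem fourier_whiskerRight (l : F.L) :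
    F.fourier (l.asHom ▷ F.bar) = F.fourierDot (ι ◁ (F.nu l).asHom) := by
  apply F.ext_endComp'
  rw [endComp_fourier, endComp_fourierDot, endComp_whiskerRight, endComp_whiskerLeft,
    ← comp_whiskerRight, whisker_exchange, comp_whiskerRight, ← unitComp_naturality_assoc,
    unitComp_whiskerLeft_nu, counitComp_naturality, counitComp_naturality_assoc]

/-- This identifies the left target map with `S⁻¹ s`, which is how the target enters the abstract
part. -/
theorem SAInv_whiskerRight (l : F.L) : F.SAInv (l.asHom ▷ F.bar) = ι ◁ (F.mu l).asHom := by
  rw [SAInv, ← fourier_whiskerLeft_mu]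
  exact F.fourierInv_fourier _

theorem SA_whiskerRight (l : F.L) : F.SA (l.asHom ▷ F.bar) = ι ◁ (F.nu l).asHom := by
  rw [SA, fourier_whiskerRight]
  exact F.fourierDotInv_fourierDot _

theorem phiL_whiskerRight_mul (l : F.L) (a : F.A) :
    F.phiL (End.of (l.asHom ▷ F.bar) * a) = l * F.phiL a := by
  refine (whiskerLeft_iff _ _).1 (?_ : (𝟙 X) ◁ _ = (𝟙 X) ◁ (F.phiL a ≫ l))
  simp only [whiskerLeft_phiL, endComp_mul, whiskerLeft_comp, endComp_whiskerRight,
    comp_whiskerRight, Category.assoc, counitComp_naturality]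

theorem phiL_iA : F.phiL F.iA = 1 := by
  refine (whiskerLeft_iff _ _).1 (?_ : (𝟙 X) ◁ _ = (𝟙 X) ◁ (𝟙 ι))
  simp only [whiskerLeft_phiL, endComp_iA, comp_whiskerRight, Category.assoc,
    unitComp_counitComp, Category.comp_id, unitComp_counitComp', Bicategory.whiskerLeft_id]

/-- By duality, 2-morphisms `1 → ι × ῑ` correspond to endomorphisms of `ι`. Hence `a ∘ coev_L` is
`(l × ῑ) ∘ coev_L` for some `l`, and applying `φ_L` after composing with `ev_R` recovers `l`. This
is the left integral property. -/
theorem mul_iA (a : F.A) :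
    a * F.iA = End.of (F.phiL (a * F.iA) ▷ F.bar) * F.iA := by
  apply F.ext_endComp
  simp only [endComp_mul, endComp_whiskerRight, whiskerLeft_phiL, endComp_iA, comp_whiskerRight,
    Category.assoc]
  rw [← comp_whiskerRight_assoc, unitComp_counitComp', id_whiskerRight, Category.id_comp,
    ← unitComp_naturality_assoc, ← unitComp_naturality_assoc, unitComp_counitComp',
    Category.comp_id]

theorem fourier_iA_mul_whiskerRight (l : F.L) :
    F.fourier (F.iA * End.of (l.asHom ▷ F.bar)) = F.nu l ▷ ι := by
  apply F.ext_endComp'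
  simp only [endComp_mul, endComp_whiskerRight, whiskerLeft_nu, endComp_iA, comp_whiskerRight,
    Category.assoc, endComp_fourier, unitComp_counitComp, Category.comp_id]

/-- Capping the right leg of `x ⋆ a` with `ev_L` completes the picture of `ℱ(a)`, which is then
applied before `x`. The next lemma is the analogue for a cup, with `ℱ̇`. -/
theorem endComp_convA_counitComp (x a : F.A) (U : W ⟶ X) :
    endComp (F.convA x a) U ▷ ι ≫ counitComp F.adjL (U ≫ ι) =
      endComp (F.fourier a) (U ≫ ι) ≫ endComp x U ▷ ι ≫ counitComp F.adjL (U ≫ ι) := by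
  simp only [endComp_convA, endComp_fourier, comp_whiskerRight, Category.assoc,
    counitComp_naturality]
  rw [← counitComp_naturality_assoc, ← endComp_naturality_whisker_assoc]

theorem unitComp_endComp_convA (y a : F.A) (U : W ⟶ X) :
    unitComp F.adjR (U ≫ ι) ≫ endComp (F.convA y a) U ▷ ι =
      unitComp F.adjR (U ≫ ι) ≫ endComp y U ▷ ι ≫ endComp (F.fourierDot a) (U ≫ ι) := by
  simp only [endComp_convA, endComp_fourierDot, comp_whiskerRight]
  rw [unitComp_naturality_assoc, unitComp_naturality_assoc]

/-- The box `a` moves around the loop of the partial trace. On either side the box between `y` and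
`x` is the same one, since `ℱ(a) = ℱ̇(S_A(a))`. -/
theorem phiL_convA_mul (x a y : F.A) :
    F.phiL (F.convA x a * y) = F.phiL (x * F.convA y (F.SA a)) := by
  refine (whiskerLeft_iff _ _).1 ?_
  rw [whiskerLeft_phiL, whiskerLeft_phiL, endComp_mul, endComp_mul, comp_whiskerRight,
    comp_whiskerRight, Category.assoc, Category.assoc, endComp_convA_counitComp,
    ← Category.assoc (unitComp _ _), ← Category.assoc (unitComp _ _), unitComp_endComp_convA,
    fourierDot_SA]
  simp only [Category.assoc]

theorem nu_mul (l l' : F.L) : F.nu (l * l') = F.nu l' * F.nu l := by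
  simp only [nu_eq]
  exact (conjugateEquiv_symm_comp F.adjR F.adjR F.adjR l' l).symm

end General

/-! ### Quasi-bases, additivity and the distributive law -/

section Additive

section

variable {C : Type u} [Bicategory.{w, v} C] [∀ a b : C, Preadditive (a ⟶ b)]
  {X Y : C} {ι : X ⟶ Y} (F : FrobeniusData ι)

/-- The retraction splits the identity of `(ι × ῑ) × ι` into maps to and from copies of `ι`; by
duality each such map is an element of `A`. Only the first half of the depth 2 condition enters; the
second half serves `ῑ`. -/
theorem exists_isQuasiBasis [∀ a b : C, HasFiniteBiproducts (a ⟶ b)] (hF : F.IsD2) :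
    ∃ (n : ℕ) (y x : Fin n → F.A), F.IsQuasiBasis y x := by
  obtain ⟨⟨n, ⟨⟨i, r, hir⟩⟩⟩, -⟩ := hF
  -- These are the transposes of the `k`-th components of `r` under `adjR` and of `i` under `adjL`;
  -- `hx` and `hy` transpose them back.
  let y : Fin n → F.A := fun k => (biproduct.ι (fun _ : Fin n => ι) k ≫ r) ▷ F.bar ≫
    counitComp F.adjR (ι ≫ F.bar)
  let x : Fin n → F.A := fun k => unitComp F.adjL (ι ≫ F.bar) ≫
    (i ≫ biproduct.π (fun _ : Fin n => ι) k) ▷ F.bar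
  refine ⟨n, y, x, ?_⟩
  have hx : ∀ k, (x k).asHom ▷ ι ≫ counitComp F.adjL ι =
      i ≫ biproduct.π (fun _ : Fin n => ι) k := fun k => by
    simp only [x, End.asHom, comp_whiskerRight, Category.assoc, counitComp_naturality,
      counitComp_naturality_assoc]
    rw [unitComp_counitComp_assoc]
  have hy : ∀ k, unitComp F.adjR ι ≫ (y k).asHom ▷ ι =
      biproduct.ι (fun _ : Fin n => ι) k ≫ r := fun k => by
    simp only [y, End.asHom, comp_whiskerRight, Category.assoc, ← unitComp_naturality_assoc]
    rw [unitComp_counitComp', Category.comp_id]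
  rw [IsQuasiBasis, ← hir]
  have hs : i ≫ r = ∑ k, (i ≫ biproduct.π (fun _ : Fin n => ι) k) ≫
      (biproduct.ι (fun _ : Fin n => ι) k ≫ r) := by
    simp only [Category.assoc]
    simp only [← Category.assoc (biproduct.π _ _), ← Preadditive.comp_sum, ← Preadditive.sum_comp,
      biproduct.total, Category.id_comp]
  rw [hs]
  refine Finset.sum_congr rfl fun k _ => ?_
  rw [← hx, ← hy]
  simp [counitComp, unitComp]

end

variable {C : Type u} [Bicategory.{w, v} C] [∀ a b : C, Preadditive (a ⟶ b)]
  [PreadditiveBicategory C]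

theorem whiskerLeft_sum {a b c : C} (f : a ⟶ b) {g h : b ⟶ c} {n : ℕ} (x : Fin n → (g ⟶ h)) :
    f ◁ (∑ i, x i) = ∑ i, f ◁ x i :=
  map_sum (AddMonoidHom.mk' (fun x : g ⟶ h => f ◁ x)
    (PreadditiveBicategory.whiskerLeft_add f)) x Finset.univ

theorem sum_whiskerRight {a b c : C} {f g : a ⟶ b} {n : ℕ} (x : Fin n → (f ⟶ g)) (h : b ⟶ c) :
    (∑ i, x i) ▷ h = ∑ i, x i ▷ h :=
  map_sum (AddMonoidHom.mk' (fun x : f ⟶ g => x ▷ h)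
    (fun x y => PreadditiveBicategory.add_whiskerRight x y h)) x Finset.univ

theorem endComp_sum {X Y W : C} {f : X ⟶ Y} {g : Y ⟶ X} {n : ℕ} (a : Fin n → End (f ≫ g))
    (U : W ⟶ X) : endComp (∑ i, a i) U = ∑ i, endComp (a i) U := by
  have h : U ◁ (∑ i, a i) = ∑ i, U ◁ a i := whiskerLeft_sum U a
  simp only [endComp]
  rw [h, Preadditive.sum_comp, Preadditive.comp_sum]

variable {X Y : C} {ι : X ⟶ Y} (F : FrobeniusData ι)

theorem end_add_def {D : Type*} [Category D] [Preadditive D] {X : D} (a b : End X) :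
    a + b = @HAdd.hAdd (X ⟶ X) (X ⟶ X) (X ⟶ X) _ a b := rfl

theorem convA_add (a b c : F.A) : F.convA a (b + c) = F.convA a b + F.convA a c := by
  simp only [convA, End.of, End.asHom, end_add_def, PreadditiveBicategory.whiskerLeft_add,
    Preadditive.comp_add, Preadditive.add_comp]

theorem add_convA (a b c : F.A) : F.convA (a + b) c = F.convA a c + F.convA b c := by
  simp only [convA, End.of, End.asHom, end_add_def, PreadditiveBicategory.add_whiskerRight,
    Preadditive.comp_add, Preadditive.add_comp]

theorem fourier_add (a b : F.A) : F.fourier (a + b) = F.fourier a + F.fourier b := by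
  simp only [fourier, End.of, End.asHom, end_add_def, PreadditiveBicategory.whiskerLeft_add,
    PreadditiveBicategory.add_whiskerRight, Preadditive.comp_add, Preadditive.add_comp]

theorem fourierDotInv_add (a b : F.B) :
    F.fourierDotInv (a + b) = F.fourierDotInv a + F.fourierDotInv b := by
  simp only [fourierDotInv, End.of, End.asHom, end_add_def, PreadditiveBicategory.whiskerLeft_add,
    PreadditiveBicategory.add_whiskerRight, Preadditive.comp_add, Preadditive.add_comp]

theorem phiL_add (a b : F.A) : F.phiL (a + b) = F.phiL a + F.phiL b := by
  simp only [phiL, End.of, End.asHom, end_add_def, PreadditiveBicategory.add_whiskerRight,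
    Preadditive.comp_add, Preadditive.add_comp]

theorem nu_add (l l' : F.L) : F.nu (l + l') = F.nu l + F.nu l' := by
  simp only [nu, End.of, End.asHom, end_add_def, PreadditiveBicategory.whiskerLeft_add,
    PreadditiveBicategory.add_whiskerRight, Preadditive.comp_add, Preadditive.add_comp]

variable {F}

theorem IsQuasiBasis.sum_endComp {n : ℕ} {y x : Fin n → F.A} (h : F.IsQuasiBasis y x) {W : C}
    (U : W ⟶ X) :
    ∑ i, endComp (x i) U ▷ ι ≫ counitComp F.adjL (U ≫ ι) ≫ unitComp F.adjR (U ≫ ι) ≫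
      endComp (y i) U ▷ ι = 𝟙 _ := by
  have e : ∀ x y : ι ≫ F.bar ⟶ ι ≫ F.bar,
      endComp x U ▷ ι ≫ counitComp F.adjL (U ≫ ι) ≫ unitComp F.adjR (U ≫ ι) ≫
        endComp y U ▷ ι = ((α_ U ι F.bar).hom ▷ ι ≫ (α_ U (ι ≫ F.bar) ι).hom) ≫
      (U ◁ (x ▷ ι ≫ (α_ ι F.bar ι).hom ≫ ι ◁ F.evL ≫ ι ◁ F.coevR ≫
        (α_ ι F.bar ι).inv ≫ y ▷ ι)) ≫ (α_ U (ι ≫ F.bar) ι).inv ≫ (α_ U ι F.bar).inv ▷ ι := by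
    intro x y
    simp only [endComp, unitComp, counitComp]
    bicategory
  simp only [e]
  rw [← Preadditive.comp_sum, ← Preadditive.sum_comp, ← whiskerLeft_sum]
  rw [IsQuasiBasis] at h
  erw [h]
  simp

/-- Slide `c` in front of `p`, then insert the resolved identity between the stage of `q`, `c` and
that of `p`, `d`. Its cap and cup cut the picture into two convolutions, composed one after the
other. -/
theorem IsQuasiBasis.convA_mul {n : ℕ} {y x : Fin n → F.A} (h : F.IsQuasiBasis y x)
    (p q d c : F.A) :
    F.convA (p * q) (d * c) = ∑ i, F.convA (p * y i) d * F.convA (x i * q) c := by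
  apply F.ext_endComp
  rw [endComp_sum, endComp_convA, endComp_mul, endComp_mul]
  have e : ∀ i, endComp (F.convA (p * y i) d * F.convA (x i * q) c) (𝟙 X) =
      (unitComp F.adjR (𝟙 X ≫ ι) ▷ F.bar ≫ endComp q (𝟙 X) ▷ ι ▷ F.bar ≫
        endComp c ((𝟙 X ≫ ι) ≫ F.bar)) ≫
      (endComp (x i) (𝟙 X) ▷ ι ≫ counitComp F.adjL (𝟙 X ≫ ι) ≫ unitComp F.adjR (𝟙 X ≫ ι) ≫
        endComp (y i) (𝟙 X) ▷ ι) ▷ F.bar ≫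
      endComp p (𝟙 X) ▷ ι ▷ F.bar ≫ endComp d ((𝟙 X ≫ ι) ≫ F.bar) ≫
        counitComp F.adjL (𝟙 X ≫ ι) ▷ F.bar := fun i => by
    simp only [endComp_mul, endComp_convA, comp_whiskerRight, Category.assoc]
    rw [endComp_naturality_assoc]
  simp only [e]
  rw [← Preadditive.comp_sum, ← Preadditive.sum_comp, ← sum_whiskerRight, h.sum_endComp]
  simp only [comp_whiskerRight, id_whiskerRight, Category.id_comp, Category.assoc]
  rw [endComp_naturality_assoc]

end Additive
end FrobeniusData

/-! ## Rings with a second, convolution product -/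

namespace BalTensor

variable {J M N : Type*} [AddCommGroup M] [AddCommGroup N] {ρ : J → M →+ M} {κ : J → N →+ N}

theorem sum_tmul {n : ℕ} (u : Fin n → M) (v : N) :
    tmul ρ κ (∑ i, u i) v = ∑ i, tmul ρ κ (u i) v := by
  rw [← tmulHom_apply, map_sum, AddMonoidHom.finsetSum_apply]
  rfl

theorem tmul_sum {n : ℕ} (u : M) (v : Fin n → N) :
    tmul ρ κ u (∑ i, v i) = ∑ i, tmul ρ κ u (v i) := by
  rw [← tmulHom_apply, map_sum]
  rfl

end BalTensor

/-- A ring `A` with a second product `conv` with unit `i`, a Frobenius homomorphism `φ` onto the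
base ring `L`, and a bijection `S` that reverses both products. The product `conv` distributes over
the composition product by means of the dual basis of `φ`. -/
structure FrobeniusDoubleRing (A L : Type*) [Ring A] [Ring L] where
  conv : A →+ A →+ A
  i : A
  S : A ≃+ A
  s : L →+* A
  φ : A →+ L
  conv_assoc : ∀ a b c, conv (conv a b) c = conv a (conv b c)
  i_conv : ∀ a, conv i a = a
  conv_i : ∀ a, conv a i = a
  S_mul : ∀ a b, S (a * b) = S b * S a
  S_conv : ∀ a b, S (conv a b) = conv (S b) (S a)
  conv_one : ∀ a, conv a 1 = s (φ a)
  s_mul_conv : ∀ l a b, s l * conv a b = conv (s l * a) b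
  conv_mul_s : ∀ l a b, conv a b * s l = conv (a * s l) b
  slide : ∀ l a b, conv (S.symm (s l) * a) b = conv a (s l * b)
  φ_s_mul : ∀ l a, φ (s l * a) = l * φ a
  φ_i : φ i = 1
  mul_i : ∀ a, a * i = s (φ (a * i)) * i
  φ_conv_mul : ∀ x a y, φ (conv x a * y) = φ (x * conv y (S a))
  exists_basis : ∃ (n : ℕ) (y x : Fin n → A), ∀ p q d c,
    conv (p * q) (d * c) = ∑ j, conv (p * y j) d * conv (x j * q) c

/-! ### Consequences of the axioms; dual bases -/

namespace FrobeniusDoubleRing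

variable {A L : Type*} [Ring A] [Ring L] (D : FrobeniusDoubleRing A L)

theorem φ_s_mul_i (l : L) : D.φ (D.s l * D.i) = l := by rw [D.φ_s_mul, D.φ_i, mul_one]

theorem s_injective : Function.Injective D.s := fun l l' h => by
  rw [← D.φ_s_mul_i l, h, D.φ_s_mul_i]

theorem φ_mul_s (a : A) (l : L) : D.φ (a * D.s l) = D.φ a * l := by
  apply D.s_injective
  rw [← D.conv_one, ← D.conv_mul_s, D.conv_one, map_mul]

theorem S_one : D.S 1 = 1 := by
  have h := D.S_mul 1 (D.S.symm 1)
  rw [one_mul, D.S.apply_symm_apply, one_mul] at h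
  exact h.symm

theorem S_i : D.S D.i = D.i := by
  have h := D.S_conv D.i (D.S.symm D.i)
  rw [D.i_conv, D.S.apply_symm_apply, D.i_conv] at h
  exact h.symm

theorem symm_S_one : D.S.symm 1 = 1 := by rw [AddEquiv.symm_apply_eq, D.S_one]

theorem symm_S_i : D.S.symm D.i = D.i := by rw [AddEquiv.symm_apply_eq, D.S_i]

theorem symm_S_mul (a b : A) : D.S.symm (a * b) = D.S.symm b * D.S.symm a := by
  rw [AddEquiv.symm_apply_eq, D.S_mul, D.S.apply_symm_apply, D.S.apply_symm_apply]

theorem symm_S_conv (a b : A) :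
    D.S.symm (D.conv a b) = D.conv (D.S.symm b) (D.S.symm a) := by
  rw [AddEquiv.symm_apply_eq, D.S_conv, D.S.apply_symm_apply, D.S.apply_symm_apply]

/-- The antipode reverses both products, so each module rule for `s` has mirror images under `S` and
`S⁻¹`. -/
theorem conv_mul_Ss (l : L) (a b : A) :
    D.conv a b * D.S (D.s l) = D.conv a (b * D.S (D.s l)) := by
  apply D.S.symm.injective
  simp only [symm_S_mul, symm_S_conv, D.S.symm_apply_apply, D.s_mul_conv]

theorem t_mul_conv (l : L) (a b : A) :
    D.S.symm (D.s l) * D.conv a b = D.conv a (D.S.symm (D.s l) * b) := by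
  apply D.S.injective
  simp only [S_mul, S_conv, D.S.apply_symm_apply, D.conv_mul_s]

theorem t_mul_i (l : L) : D.S.symm (D.s l) * D.i = D.s l * D.i := by
  rw [← D.conv_i (D.S.symm (D.s l) * D.i), D.slide, D.i_conv]

/-- The target map lives in the second convolution factor while `s` acts on the first, which is why
the two commute in `s_mul_t`. -/
theorem t_eq (l : L) : D.S.symm (D.s l) = D.conv 1 (D.s l * D.i) := by
  rw [← D.slide, mul_one, D.conv_i]

theorem s_mul_t (l l' : L) : D.s l * D.S.symm (D.s l') = D.S.symm (D.s l') * D.s l := by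
  rw [t_eq, D.s_mul_conv, mul_one, ← D.slide, D.conv_i, ← t_eq]

theorem s_mul_Ss (l l' : L) : D.s l * D.S (D.s l') = D.S (D.s l') * D.s l := by
  have h := congrArg D.S (D.s_mul_t l' l)
  rw [D.S_mul, D.S_mul, D.S.apply_symm_apply] at h
  exact h

theorem φ_t_mul (l : L) (a : A) :
    D.φ (D.S.symm (D.s l) * a * D.i) = D.φ (a * D.i) * l := by
  rw [mul_assoc, D.mul_i a, ← mul_assoc, ← D.s_mul_t, mul_assoc, t_mul_i, D.φ_s_mul, D.φ_s_mul,
    D.φ_s_mul, D.φ_i, mul_one, mul_one]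

theorem φ_mul_i (a : A) : D.φ (a * D.i) = D.φ (D.i * D.S a) := by
  have h := D.φ_conv_mul D.i a D.i
  rwa [D.i_conv, D.i_conv] at h

/-- The map `s φ` is convolution with `1` on the right, and `S²` preserves convolution and `1`.
Consequently `S²` preserves the image of `s`. -/
theorem SS_sφ (a : A) : D.S (D.S (D.s (D.φ a))) = D.s (D.φ (D.S (D.S a))) := by
  rw [← D.conv_one, D.S_conv, D.S_conv, D.S_one, D.S_one, D.conv_one]

theorem symm_SS_sφ (a : A) :
    D.S.symm (D.S.symm (D.s (D.φ a))) = D.s (D.φ (D.S.symm (D.S.symm a))) := by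
  rw [← D.conv_one, D.symm_S_conv, D.symm_S_conv, D.symm_S_one, D.symm_S_one, D.conv_one]

/-- A family that expands every element by means of `φ`. -/
def IsDualBasis {n : ℕ} (y x : Fin n → A) : Prop := ∀ a, ∑ j, y j * D.s (D.φ (x j * a)) = a

/-- A family with respect to which `conv` distributes over the composition product. -/
def IsDistributive {n : ℕ} (y x : Fin n → A) : Prop := ∀ p q d c,
    D.conv (p * q) (d * c) = ∑ j, D.conv (p * y j) d * D.conv (x j * q) c

variable {D}

/-- The choice `p = 1`, `d = i`, `c = 1` reduces the distributive law to an expansion by `φ`. The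
opposite expansion comes from exchanging the roles of the units. -/
theorem IsDistributive.isDualBasis {n : ℕ} {y x : Fin n → A} (h : D.IsDistributive y x) :
    D.IsDualBasis y x := fun a => by
  have := h 1 a D.i 1
  simpa only [one_mul, mul_one, D.conv_i, D.conv_one] using this.symm

theorem IsDistributive.sum_mul {n : ℕ} {y x : Fin n → A} (h : D.IsDistributive y x) (a : A) :
    ∑ j, D.s (D.φ (a * y j)) * x j = a := by
  have := h a 1 1 D.i
  simpa only [one_mul, mul_one, D.conv_i, D.conv_one] using this.symm

/-- A one-sided dual basis is two-sided: expand `x j` in a distributive family, for which both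
expansions are known, and contract over `j`. -/
theorem IsDualBasis.sum_mul {n : ℕ} {y x : Fin n → A} (h : D.IsDualBasis y x) (a : A) :
    ∑ j, D.s (D.φ (a * y j)) * x j = a := by
  obtain ⟨m, y', x', h'⟩ := D.exists_basis
  have h' : D.IsDistributive y' x' := h'
  calc ∑ j, D.s (D.φ (a * y j)) * x j
      = ∑ j, ∑ k, D.s (D.φ (a * (y j * D.s (D.φ (x j * y' k))))) * x' k := by
        refine Finset.sum_congr rfl fun j _ => ?_
        conv_lhs => rw [← h'.sum_mul (x j), Finset.mul_sum]
        refine Finset.sum_congr rfl fun k _ => ?_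
        rw [← mul_assoc a, D.φ_mul_s, map_mul D.s, mul_assoc]
    _ = a := by
        rw [Finset.sum_comm]
        conv_rhs => rw [← h'.sum_mul a]
        refine Finset.sum_congr rfl fun k _ => ?_
        rw [← Finset.sum_mul, ← map_sum, ← map_sum, ← Finset.mul_sum, h (y' k)]

theorem IsDualBasis.sum_conv_mul {n : ℕ} {y x : Fin n → A} (h : D.IsDualBasis y x) (a c : A) :
    ∑ j, D.conv (y j) c * D.s (D.φ (x j * a)) = D.conv a c := by
  simp only [D.conv_mul_s]
  rw [← AddMonoidHom.finsetSum_apply, ← map_sum, h a]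

theorem IsDualBasis.S_sq {n : ℕ} {y x : Fin n → A} (h : D.IsDualBasis y x) :
    D.IsDualBasis (fun j => D.S (D.S (y j))) (fun j => D.S (D.S (x j))) := fun a => by
  obtain ⟨a, rfl⟩ := D.S.surjective a
  obtain ⟨a, rfl⟩ := D.S.surjective a
  conv_rhs => rw [← h a]
  simp only [map_sum, ← D.S_mul, ← D.SS_sφ]

theorem IsDualBasis.symm_S_sq {n : ℕ} {y x : Fin n → A} (h : D.IsDualBasis y x) :
    D.IsDualBasis (fun j => D.S.symm (D.S.symm (y j))) (fun j => D.S.symm (D.S.symm (x j))) :=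
  fun a => by
  obtain ⟨a, rfl⟩ := D.S.symm.surjective a
  obtain ⟨a, rfl⟩ := D.S.symm.surjective a
  conv_rhs => rw [← h a]
  simp only [map_sum, ← D.symm_S_mul, ← D.symm_SS_sφ]

variable (D)

/-- The cardinality of a chosen distributive family. -/
noncomputable def rk : ℕ := D.exists_basis.choose
/-- The first component of a chosen distributive family. -/
noncomputable def y : Fin D.rk → A := D.exists_basis.choose_spec.choose
/-- The second component of a chosen distributive family. -/
noncomputable def x : Fin D.rk → A := D.exists_basis.choose_spec.choose_spec.choose

theorem isDistributive : D.IsDistributive D.y D.x :=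
  D.exists_basis.choose_spec.choose_spec.choose_spec

theorem isDualBasis : D.IsDualBasis D.y D.x := D.isDistributive.isDualBasis

/-! ### The left bialgebroid -/

/-- The source map `s` and the target map `S⁻¹ s`. -/
def leftST : SourceTarget A L where
  s := D.s
  t :=
    { toFun := fun l => D.S.symm (D.s l.unop)
      map_one' := by rw [MulOpposite.unop_one, map_one, D.symm_S_one]
      map_mul' := fun l l' => by rw [MulOpposite.unop_mul, map_mul, D.symm_S_mul]
      map_zero' := by rw [MulOpposite.unop_zero, map_zero, map_zero]
      map_add' := fun l l' => by rw [MulOpposite.unop_add, map_add, map_add] }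
  comm := D.s_mul_t

@[simp] theorem leftST_s (l : L) : D.leftST.s l = D.s l := rfl
@[simp] theorem leftST_t (l : L) : D.leftST.t (.op l) = D.S.symm (D.s l) := rfl

theorem left_balanced (l : L) (a b : A) :
    BalTensor.tmul D.leftST.tLeft D.leftST.sLeft (D.S.symm (D.s l) * a) b =
      BalTensor.tmul _ _ a (D.s l * b) :=
  BalTensor.balanced (ρ := D.leftST.tLeft) (κ := D.leftST.sLeft) l a b

/-- Expand `xⱼ ⋆ a` in the second basis, move the coefficients across the tensor sign, transfer `a`
onto `y'ₖ` by `φ_conv_mul`, and contract over `j`. This yields both the agreement of the two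
coproduct formulas and independence of the basis. -/
theorem sum_leftTmul_eq {n m : ℕ} {y x : Fin n → A} {y' x' : Fin m → A}
    (h : D.IsDualBasis y x) (h' : D.IsDualBasis y' x') (a : A) :
    ∑ j, BalTensor.tmul D.leftST.tLeft D.leftST.sLeft (D.S.symm (y j)) (D.conv (x j) a) =
      ∑ k, BalTensor.tmul _ _ (D.conv a (D.S.symm (y' k))) (x' k) := by
  have e : ∀ j, BalTensor.tmul D.leftST.tLeft D.leftST.sLeft (D.S.symm (y j)) (D.conv (x j) a) =
      ∑ k, BalTensor.tmul _ _
        (D.S.symm (y j * D.s (D.φ (x j * D.conv (y' k) (D.S a))))) (x' k) := fun j => by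
    conv_lhs => rw [← h'.sum_mul (D.conv (x j) a), BalTensor.tmul_sum]
    simp only [← D.left_balanced, D.symm_S_mul, D.φ_conv_mul]
  simp only [e]
  rw [Finset.sum_comm]
  refine Finset.sum_congr rfl fun k _ => ?_
  rw [← BalTensor.sum_tmul, ← map_sum, h, D.symm_S_conv, D.S.symm_apply_apply]

/-- The coproduct of the left bialgebroid. -/
noncomputable def leftγ : A →+ D.leftST.LeftTensor :=
  AddMonoidHom.mk' (fun a => ∑ j, BalTensor.tmul _ _ (D.S.symm (D.y j)) (D.conv (D.x j) a))
    (fun a b => by simp only [map_add, BalTensor.tmul_add, Finset.sum_add_distrib])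

theorem leftγ_eq_right {n : ℕ} {y x : Fin n → A} (h : D.IsDualBasis y x) (a : A) :
    D.leftγ a = ∑ j, BalTensor.tmul _ _ (D.conv a (D.S.symm (y j))) (x j) :=
  D.sum_leftTmul_eq D.isDualBasis h a

theorem leftγ_eq_left {n : ℕ} {y x : Fin n → A} (h : D.IsDualBasis y x) (a : A) :
    D.leftγ a = ∑ j, BalTensor.tmul _ _ (D.S.symm (y j)) (D.conv (x j) a) := by
  rw [D.leftγ_eq_right h, D.sum_leftTmul_eq h h]

/-- The additive map `c ⊗ d ↦ S(c) ((d p) ⋆ e)`. -/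
noncomputable def leftTest (p e : A) : D.leftST.LeftTensor →+ A :=
  BalTensor.lift ((AddMonoidHom.mul.comp D.S.toAddMonoidHom).compl₂
      ((D.conv.flip e).comp (AddMonoidHom.mulRight p)))
    (fun l c d => by
      change D.S (D.S.symm (D.s l) * c) * D.conv (d * p) e =
        D.S c * D.conv (D.s l * d * p) e
      rw [D.S_mul, D.S.apply_symm_apply, mul_assoc, D.s_mul_conv, mul_assoc])

@[simp] theorem leftTest_tmul (p e c d : A) :
    D.leftTest p e (BalTensor.tmul _ _ c d) = D.S c * D.conv (d * p) e := rfl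

/-- On the standard representative of the coproduct, the test map produces the right-hand side of
the distributive law with first entry `1`. -/
theorem leftTest_leftγ (p e a : A) : D.leftTest p e (D.leftγ a) = D.conv p (D.S a * e) := by
  rw [D.leftγ_eq_right D.isDualBasis, map_sum]
  have h := D.isDistributive 1 p (D.S a) e
  simp only [one_mul] at h
  rw [h]
  refine Finset.sum_congr rfl fun j _ => ?_
  rw [leftTest_tmul, D.S_conv, D.S.apply_symm_apply]

theorem leftTest_leftTensorMul (p e c d : A) (z : D.leftST.LeftTensor) :
    D.leftTest p e (D.leftST.leftTensorMul c d z) = D.S c * D.leftTest (d * p) e z := by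
  obtain ⟨n, u, v, rfl⟩ := BalTensor.exists_sum z
  simp only [map_sum, SourceTarget.leftTensorMul_tmul, leftTest_tmul, Finset.mul_sum, D.S_mul,
    mul_assoc]

/-- A tensor is recovered from its tests at `p = yₖ`, as `∑ S⁻¹(test) ⊗ xₖ`. -/
theorem leftTensor_ext {z z' : D.leftST.LeftTensor}
    (h : ∀ p, D.leftTest p 1 z = D.leftTest p 1 z') : z = z' := by
  have e : ∀ z : D.leftST.LeftTensor,
      z = ∑ k, BalTensor.tmul _ _ (D.S.symm (D.leftTest (D.y k) 1 z)) (D.x k) := fun z => by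
    obtain ⟨n, u, v, rfl⟩ := BalTensor.exists_sum z
    simp only [map_sum, leftTest_tmul, BalTensor.sum_tmul, D.symm_S_mul, D.conv_one,
      D.S.symm_apply_apply, D.left_balanced]
    rw [Finset.sum_comm]
    refine Finset.sum_congr rfl fun i _ => ?_
    rw [← BalTensor.tmul_sum, D.isDistributive.sum_mul]
  rw [e z, e z']
  simp only [h]

/-- The left bialgebroid of a Frobenius double ring. -/
noncomputable def left : LeftBialgebroid A L where
  toSourceTarget := D.leftST
  γ := D.leftγ
  π := D.φ.comp (AddMonoidHom.mulRight D.i)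
  γ_s_mul l a := by
    simp only [D.leftγ_eq_right D.isDualBasis, map_sum, SourceTarget.sLeft_apply,
      BalTensor.mapL_tmul, leftST_s, D.s_mul_conv]
  γ_t_mul l a := by
    simp only [D.leftγ_eq_left D.isDualBasis, map_sum, SourceTarget.tLeft_apply,
      BalTensor.mapR_tmul, leftST_t, D.t_mul_conv]
  π_s_mul l a := by
    change D.φ (D.s l * a * D.i) = l * D.φ (a * D.i)
    rw [mul_assoc, D.φ_s_mul]
  π_t_mul l a := D.φ_t_mul l a
  coassoc a := by
    -- Both sides are `∑ S⁻¹(yⱼ) ⊗ (xⱼ ⋆ a ⋆ S⁻¹(yₖ)) ⊗ xₖ`: coassociativity reduces to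
    -- associativity of convolution.
    conv_lhs => rw [D.leftγ_eq_right D.isDualBasis a, map_sum, map_sum]
    conv_rhs => rw [D.leftγ_eq_left D.isDualBasis a, map_sum]
    simp only [BalTensor.mapL_tmul, BalTensor.mapR_tmul]
    simp only [D.leftγ_eq_left D.isDualBasis (D.conv a _),
      D.leftγ_eq_right D.isDualBasis (D.conv _ a), BalTensor.sum_tmul, BalTensor.tmul_sum, map_sum,
      BalTensor.assoc_tmul, D.conv_assoc]
    exact Finset.sum_comm
  counit_left a := by
    rw [D.leftγ_eq_left D.isDualBasis, map_sum]
    change ∑ j, D.s (D.φ (D.S.symm (D.y j) * D.i)) * D.conv (D.x j) a = a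
    -- The coefficients become `φ(i yⱼ)`, so the sum is the dual basis expansion of `i`, convolved
    -- with `a`.
    simp only [D.s_mul_conv, D.φ_mul_i, D.S.apply_symm_apply]
    rw [← AddMonoidHom.finsetSum_apply, ← map_sum, D.isDistributive.sum_mul, D.i_conv]
  counit_right a := by
    rw [D.leftγ_eq_right D.isDualBasis, map_sum]
    change ∑ j, D.S.symm (D.s (D.φ (D.x j * D.i))) * D.conv a (D.S.symm (D.y j)) = a
    simp only [D.t_mul_conv, ← D.symm_S_mul]
    rw [← map_sum, ← map_sum, D.isDualBasis, D.symm_S_i, D.conv_i]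
  cross a l := by
    refine D.leftTensor_ext fun p => ?_
    rw [leftTest_leftTensorMul, leftTest_leftTensorMul, leftTest_leftγ, leftTest_leftγ, leftST_s,
      leftST_t, D.S.apply_symm_apply, D.S_one, D.s_mul_conv, one_mul, one_mul]
  γ_one := by
    refine D.leftTensor_ext fun p => ?_
    rw [leftTest_leftγ, leftTest_tmul, D.S_one]
    simp only [one_mul]
  γ_mul a b n c d h := by
    refine D.leftTensor_ext fun p => ?_
    -- The parameter `e` of the test map absorbs `S(a)`: testing the coproduct of `b` with it gives
    -- `p ⋆ (S(b) S(a))`, which is the test of the coproduct of `a b`.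
    have e := congrArg (D.leftTest p (D.S a)) h
    rw [leftTest_leftγ] at e
    simp only [map_sum, leftTest_leftTensorMul, leftTest_leftγ, mul_one, D.S_mul, e, leftTest_tmul]
  π_one := by
    change D.φ (1 * D.i) = 1
    rw [one_mul, D.φ_i]
  π_mul_s a b := by
    change D.φ (a * D.s (D.φ (b * D.i)) * D.i) = D.φ (a * b * D.i)
    rw [mul_assoc, mul_assoc, ← D.mul_i]
  π_mul_t a b := by
    change D.φ (a * D.S.symm (D.s (D.φ (b * D.i))) * D.i) = D.φ (a * b * D.i)
    rw [mul_assoc, mul_assoc, D.t_mul_i, ← D.mul_i]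

end FrobeniusDoubleRing

namespace FrobeniusDoubleRing

variable {A L R : Type*} [Ring A] [Ring L] [Ring R] (D : FrobeniusDoubleRing A L)
  (ν : L ≃+* Rᵐᵒᵖ)

/-! ### The right bialgebroid -/

/-- The source map `S s ν⁻¹` and the target map `s ν⁻¹`. -/
def rightST : SourceTarget A R where
  s :=
    { toFun := fun r => D.S (D.s (ν.symm (.op r)))
      map_one' := by rw [MulOpposite.op_one, map_one, map_one, D.S_one]
      map_mul' := fun r r' => by rw [MulOpposite.op_mul, map_mul, map_mul, D.S_mul]
      map_zero' := by rw [MulOpposite.op_zero, map_zero, map_zero, map_zero]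
      map_add' := fun r r' => by rw [MulOpposite.op_add, map_add, map_add, map_add] }
  t := D.s.comp ν.symm.toRingHom
  comm r r' := (D.s_mul_Ss _ _).symm

@[simp] theorem rightST_s (r : R) : (D.rightST ν).s r = D.S (D.s (ν.symm (.op r))) := rfl
@[simp] theorem rightST_t (r : R) : (D.rightST ν).t (.op r) = D.s (ν.symm (.op r)) := rfl

theorem right_balanced (l : L) (a b : A) :
    BalTensor.tmul (D.rightST ν).sRight (D.rightST ν).tRight (a * D.S (D.s l)) b =
      BalTensor.tmul _ _ a (b * D.s l) := by
  have h := BalTensor.balanced (ρ := (D.rightST ν).sRight) (κ := (D.rightST ν).tRight)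
    (ν l).unop a b
  rwa [SourceTarget.sRight_apply, SourceTarget.tRight_apply, rightST_s, rightST_t,
    MulOpposite.op_unop, RingEquiv.symm_apply_apply] at h

/-- Mirror image of `sum_leftTmul_eq`, with the two kinds of dual basis expansion interchanged. -/
theorem sum_rightTmul_eq {n m : ℕ} {y x : Fin n → A} {y' x' : Fin m → A}
    (h : D.IsDualBasis y x) (h' : D.IsDualBasis y' x') (a : A) :
    ∑ j, BalTensor.tmul (D.rightST ν).sRight (D.rightST ν).tRight (D.S (x j)) (D.conv (y j) a) =
      ∑ k, BalTensor.tmul _ _ (D.conv a (D.S (x' k))) (y' k) := by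
  have e : ∀ j, BalTensor.tmul (D.rightST ν).sRight (D.rightST ν).tRight
        (D.S (x j)) (D.conv (y j) a) =
      ∑ k, BalTensor.tmul _ _
        (D.S (D.s (D.φ (D.conv (x' k) (D.S.symm a) * y j)) * x j)) (y' k) := fun j => by
    conv_lhs => rw [← h' (D.conv (y j) a), BalTensor.tmul_sum]
    simp only [← D.right_balanced, D.S_mul, D.φ_conv_mul, D.S.apply_symm_apply]
  simp only [e]
  rw [Finset.sum_comm]
  refine Finset.sum_congr rfl fun k _ => ?_
  rw [← BalTensor.sum_tmul, ← map_sum, h.sum_mul, D.S_conv, D.S.apply_symm_apply]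

/-- The coproduct of the right bialgebroid. -/
noncomputable def rightγ : A →+ (D.rightST ν).RightTensor :=
  AddMonoidHom.mk' (fun a => ∑ j, BalTensor.tmul _ _ (D.S (D.x j)) (D.conv (D.y j) a))
    (fun a b => by simp only [map_add, BalTensor.tmul_add, Finset.sum_add_distrib])

theorem rightγ_eq_right {n : ℕ} {y x : Fin n → A} (h : D.IsDualBasis y x) (a : A) :
    D.rightγ ν a = ∑ j, BalTensor.tmul _ _ (D.conv a (D.S (x j))) (y j) :=
  D.sum_rightTmul_eq ν D.isDualBasis h a

theorem rightγ_eq_left {n : ℕ} {y x : Fin n → A} (h : D.IsDualBasis y x) (a : A) :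
    D.rightγ ν a = ∑ j, BalTensor.tmul _ _ (D.S (x j)) (D.conv (y j) a) := by
  rw [D.rightγ_eq_right ν h, D.sum_rightTmul_eq ν h h]

/-- The additive map `c ⊗ d ↦ d ((S⁻¹(c) p) ⋆ e)`. -/
noncomputable def rightTest (p e : A) : (D.rightST ν).RightTensor →+ A :=
  BalTensor.lift (AddMonoidHom.mul.compl₂
      ((D.conv.flip e).comp ((AddMonoidHom.mulRight p).comp D.S.symm.toAddMonoidHom))).flip
    (fun r c d => by
      change d * D.conv (D.S.symm (c * D.S (D.s _)) * p) e =
        d * D.s (ν.symm (.op r)) * D.conv (D.S.symm c * p) e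
      rw [D.symm_S_mul, D.S.symm_apply_apply, mul_assoc, mul_assoc, D.s_mul_conv])

@[simp] theorem rightTest_tmul (p e c d : A) :
    D.rightTest ν p e (BalTensor.tmul _ _ c d) = d * D.conv (D.S.symm c * p) e := rfl

/-- Again the distributive law with first entry `1`; here the antipode cancels, so `a` itself
appears. -/
theorem rightTest_rightγ (p e a : A) : D.rightTest ν p e (D.rightγ ν a) = D.conv p (a * e) := by
  rw [D.rightγ_eq_left ν D.isDualBasis, map_sum]
  have h := D.isDistributive 1 p a e
  simp only [one_mul] at h
  rw [h]
  refine Finset.sum_congr rfl fun j _ => ?_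
  rw [rightTest_tmul, D.S.symm_apply_apply]

theorem rightTest_rightTensorMul (p e c d : A) (z : (D.rightST ν).RightTensor) :
    D.rightTest ν p e ((D.rightST ν).rightTensorMul c d z) =
      d * D.rightTest ν (D.S.symm c * p) e z := by
  obtain ⟨n, u, v, rfl⟩ := BalTensor.exists_sum z
  simp only [map_sum, SourceTarget.rightTensorMul_tmul, rightTest_tmul, Finset.mul_sum,
    D.symm_S_mul, mul_assoc]

theorem rightTensor_ext {z z' : (D.rightST ν).RightTensor}
    (h : ∀ p, D.rightTest ν p 1 z = D.rightTest ν p 1 z') : z = z' := by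
  have e : ∀ z : (D.rightST ν).RightTensor,
      z = ∑ k, BalTensor.tmul _ _ (D.S (D.x k)) (D.rightTest ν (D.y k) 1 z) := fun z => by
    obtain ⟨n, u, v, rfl⟩ := BalTensor.exists_sum z
    simp only [map_sum, rightTest_tmul, BalTensor.tmul_sum, D.conv_one, ← D.right_balanced,
      ← D.S_mul]
    rw [Finset.sum_comm]
    refine Finset.sum_congr rfl fun i _ => ?_
    rw [← BalTensor.sum_tmul, ← map_sum, D.isDistributive.sum_mul, D.S.apply_symm_apply]
  rw [e z, e z']
  simp only [h]

/-- The counit of the right bialgebroid. -/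
def rightπ : A →+ R :=
  (MulOpposite.opAddEquiv.symm.toAddMonoidHom.comp ν.toRingHom.toAddMonoidHom).comp
    (D.φ.comp ((AddMonoidHom.mulRight D.i).comp D.S.symm.toAddMonoidHom))

theorem rightπ_apply (a : A) : D.rightπ ν a = (ν (D.φ (D.S.symm a * D.i))).unop := rfl

theorem s_rightπ (a : A) :
    D.S (D.s (ν.symm (.op (D.rightπ ν a)))) = D.S (D.s (D.φ (D.S.symm a * D.i))) := by
  rw [rightπ_apply, MulOpposite.op_unop, RingEquiv.symm_apply_apply]

theorem t_rightπ (a : A) :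
    D.s (ν.symm (.op (D.rightπ ν a))) = D.s (D.φ (D.S.symm a * D.i)) := by
  rw [rightπ_apply, MulOpposite.op_unop, RingEquiv.symm_apply_apply]

/-- The right bialgebroid of a Frobenius double ring. -/
noncomputable def right : RightBialgebroid A R where
  toSourceTarget := D.rightST ν
  γ := D.rightγ ν
  π := D.rightπ ν
  γ_mul_s r a := by
    simp only [D.rightγ_eq_left ν D.isDualBasis, map_sum, SourceTarget.sRight_apply,
      BalTensor.mapR_tmul, rightST_s, D.conv_mul_Ss]
  γ_mul_t r a := by
    simp only [D.rightγ_eq_right ν D.isDualBasis, map_sum, SourceTarget.tRight_apply,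
      BalTensor.mapL_tmul, rightST_t, D.conv_mul_s]
  π_mul_s r a := by
    change D.rightπ ν (a * D.S (D.s (ν.symm (.op r)))) = _
    rw [rightπ_apply, rightπ_apply, D.symm_S_mul, D.S.symm_apply_apply, mul_assoc, D.φ_s_mul,
      map_mul, RingEquiv.apply_symm_apply, MulOpposite.unop_mul, MulOpposite.unop_op]
  π_mul_t r a := by
    change D.rightπ ν (a * D.s (ν.symm (.op r))) = _
    rw [rightπ_apply, rightπ_apply, D.symm_S_mul, D.φ_t_mul,
      map_mul, RingEquiv.apply_symm_apply, MulOpposite.unop_mul, MulOpposite.unop_op]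
  coassoc a := by
    conv_lhs => rw [D.rightγ_eq_right ν D.isDualBasis a, map_sum, map_sum]
    conv_rhs => rw [D.rightγ_eq_left ν D.isDualBasis a, map_sum]
    simp only [BalTensor.mapL_tmul, BalTensor.mapR_tmul]
    simp only [D.rightγ_eq_left ν D.isDualBasis (D.conv a _),
      D.rightγ_eq_right ν D.isDualBasis (D.conv _ a), BalTensor.sum_tmul, BalTensor.tmul_sum,
      map_sum, BalTensor.assoc_tmul, D.conv_assoc]
    exact Finset.sum_comm
  counit_left a := by
    rw [D.rightγ_eq_left ν D.isDualBasis, map_sum]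
    change ∑ j, D.conv (D.y j) a * D.s (ν.symm (.op (D.rightπ ν (D.S (D.x j))))) = a
    simp only [t_rightπ, D.S.symm_apply_apply]
    rw [D.isDualBasis.sum_conv_mul, D.i_conv]
  counit_right a := by
    rw [D.rightγ_eq_right ν D.isDualBasis, map_sum]
    change ∑ j, D.conv a (D.S (D.x j)) * D.S (D.s (ν.symm (.op (D.rightπ ν (D.y j))))) = a
    simp only [s_rightπ, D.conv_mul_Ss, ← D.S_mul, D.φ_mul_i, D.S.apply_symm_apply]
    rw [← map_sum, ← map_sum, D.isDualBasis.sum_mul, D.S_i, D.conv_i]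
  cross a r := by
    refine D.rightTensor_ext ν fun p => ?_
    rw [rightTest_rightTensorMul, rightTest_rightTensorMul, rightTest_rightγ, rightTest_rightγ,
      rightST_s, rightST_t, D.S.symm_apply_apply, D.symm_S_one, D.s_mul_conv, one_mul, one_mul]
  γ_one := by
    refine D.rightTensor_ext ν fun p => ?_
    rw [rightTest_rightγ, rightTest_tmul, D.symm_S_one]
    simp only [one_mul]
  γ_mul a b n c d h := by
    refine D.rightTensor_ext ν fun p => ?_
    have e := congrArg (D.rightTest ν p b) h
    rw [rightTest_rightγ] at e
    simp only [map_sum, rightTest_rightTensorMul, rightTest_rightγ, mul_one, e, rightTest_tmul]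
  π_one := by
    rw [rightπ_apply, D.symm_S_one, one_mul, D.φ_i, map_one, MulOpposite.unop_one]
  π_s_mul a b := by
    change D.rightπ ν (D.S (D.s (ν.symm (.op (D.rightπ ν a)))) * b) = _
    rw [s_rightπ, rightπ_apply, rightπ_apply, D.symm_S_mul, D.symm_S_mul, D.S.symm_apply_apply,
      mul_assoc, mul_assoc, ← D.mul_i]
  π_t_mul a b := by
    change D.rightπ ν (D.s (ν.symm (.op (D.rightπ ν a))) * b) = _
    rw [t_rightπ, rightπ_apply, rightπ_apply, D.symm_S_mul, D.symm_S_mul,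
      mul_assoc, mul_assoc, D.t_mul_i, ← D.mul_i]

/-! ### The Hopf algebroid -/

theorem left_γ_eq_right {n : ℕ} {y x : Fin n → A} (h : D.IsDualBasis y x) (a : A) :
    D.left.γ a = ∑ j, BalTensor.tmul D.left.tLeft D.left.sLeft
      (D.conv a (D.S.symm (y j))) (x j) :=
  D.leftγ_eq_right h a

theorem left_γ_eq_left {n : ℕ} {y x : Fin n → A} (h : D.IsDualBasis y x) (a : A) :
    D.left.γ a = ∑ j, BalTensor.tmul D.left.tLeft D.left.sLeft
      (D.S.symm (y j)) (D.conv (x j) a) :=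
  D.leftγ_eq_left h a

theorem right_γ_eq_right {n : ℕ} {y x : Fin n → A} (h : D.IsDualBasis y x) (a : A) :
    (D.right ν).γ a = ∑ j, BalTensor.tmul (D.right ν).sRight (D.right ν).tRight
      (D.conv a (D.S (x j))) (y j) :=
  D.rightγ_eq_right ν h a

theorem right_γ_eq_left {n : ℕ} {y x : Fin n → A} (h : D.IsDualBasis y x) (a : A) :
    (D.right ν).γ a = ∑ j, BalTensor.tmul (D.right ν).sRight (D.right ν).tRight
      (D.S (x j)) (D.conv (y j) a) :=
  D.rightγ_eq_left ν h a

/-- Contracting the two legs of the basis in this way occurs in both antipode axioms. -/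
theorem sum_conv_mul_of_isDistributive {n : ℕ} {y x : Fin n → A} (h : D.IsDistributive y x)
    (d : A) : ∑ j, D.conv (y j) d * x j = D.conv 1 (d * D.i) := by
  have := h 1 1 d D.i
  simpa only [one_mul, mul_one, D.conv_i] using this.symm

/-- Since `S²` preserves the image of `s`, the maps `S s` and `S⁻¹ s` have the same image; with
`t_eq_Ss` this gives `range_t`. -/
theorem Ss_eq_t (l : L) :
    D.S (D.s l) = D.S.symm (D.s (D.φ (D.S (D.S (D.s l * D.i))))) := by
  rw [← D.SS_sφ, D.S.symm_apply_apply, D.φ_s_mul_i]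

theorem t_eq_Ss (l : L) :
    D.S.symm (D.s l) = D.S (D.s (D.φ (D.S.symm (D.S.symm (D.s l * D.i))))) := by
  rw [← D.symm_SS_sφ, D.S.apply_symm_apply, D.φ_s_mul_i]

/-- The Hopf algebroid of a Frobenius double ring. -/
noncomputable abbrev hopf : HopfAlgebroid A L R where
  left := D.left
  right := D.right ν
  S := D.S
  base_iso := ⟨(RingEquiv.opOp R).trans (RingEquiv.op ν).symm⟩
  range_s := by
    ext a
    constructor
    · rintro ⟨l, rfl⟩
      exact ⟨ν l, congrArg D.s (ν.symm_apply_apply l)⟩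
    · rintro ⟨r, rfl⟩
      exact ⟨ν.symm r, rfl⟩
  range_t := by
    ext a
    constructor
    · rintro ⟨⟨l⟩, rfl⟩
      refine ⟨(ν (D.φ (D.S.symm (D.S.symm (D.s l * D.i))))).unop, ?_⟩
      refine Eq.trans ?_ (D.t_eq_Ss l).symm
      exact congrArg (fun l => D.S (D.s l)) (ν.symm_apply_apply _)
    · rintro ⟨r, rfl⟩
      exact ⟨.op (D.φ (D.S (D.S (D.s (ν.symm (.op r)) * D.i)))), (D.Ss_eq_t _).symm⟩
  coassoc_left_right a := by
    -- The common value is `∑ S⁻¹(yⱼ) ⊗ (xⱼ ⋆ a ⋆ S(xₖ)) ⊗ yₖ`.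
    conv_lhs => rw [D.right_γ_eq_right ν D.isDualBasis a, map_sum, map_sum]
    conv_rhs => rw [D.left_γ_eq_left D.isDualBasis a, map_sum]
    simp only [BalTensor.mapL_tmul, BalTensor.mapR_tmul]
    simp only [D.left_γ_eq_left D.isDualBasis (D.conv a _),
      D.right_γ_eq_right ν D.isDualBasis (D.conv _ a), BalTensor.sum_tmul, BalTensor.tmul_sum,
      map_sum, BalTensor.assoc_tmul, D.conv_assoc]
    exact Finset.sum_comm
  coassoc_right_left a := by
    conv_lhs => rw [D.left_γ_eq_right D.isDualBasis a, map_sum, map_sum]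
    conv_rhs => rw [D.right_γ_eq_left ν D.isDualBasis a, map_sum]
    simp only [BalTensor.mapL_tmul, BalTensor.mapR_tmul]
    simp only [D.right_γ_eq_left ν D.isDualBasis (D.conv a _),
      D.left_γ_eq_right D.isDualBasis (D.conv _ a), BalTensor.sum_tmul, BalTensor.tmul_sum,
      map_sum, BalTensor.assoc_tmul, D.conv_assoc]
    exact Finset.sum_comm
  S_left l l' a := by
    change D.S (D.S.symm (D.s l) * a * D.S.symm (D.s l')) = D.s l' * D.S a * D.s l
    rw [D.S_mul, D.S_mul, D.S.apply_symm_apply, D.S.apply_symm_apply, mul_assoc]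
  S_right r r' a := by
    change D.S (D.s (ν.symm (.op r')) * a * D.s (ν.symm (.op r))) =
      D.S (D.s _) * D.S a * D.S (D.s _)
    rw [D.S_mul, D.S_mul, mul_assoc]
  antipode_left a := by
    change BalTensor.lift _ _ (D.leftγ a) = D.S (D.s (ν.symm (.op (D.rightπ ν a))))
    rw [s_rightπ, D.leftγ_eq_right D.isDualBasis, map_sum]
    change ∑ j, D.S (D.conv a (D.S.symm (D.y j))) * D.x j = _
    -- The sum is `∑ (yⱼ ⋆ S(a)) xⱼ = 1 ⋆ (S(a) i)`, the image under `S` of `(i a) ⋆ 1 = s(φ(i a))`.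
    simp only [D.S_conv, D.S.apply_symm_apply]
    rw [D.sum_conv_mul_of_isDistributive D.isDistributive, D.φ_mul_i, D.S.apply_symm_apply,
      ← D.conv_one, D.S_conv, D.S_one, D.S_mul, D.S_i]
  antipode_right a := by
    change BalTensor.lift _ _ (D.rightγ ν a) = D.s (D.φ (a * D.i))
    rw [D.rightγ_eq_left ν D.isDualBasis, map_sum]
    change ∑ j, D.S (D.x j) * D.S (D.conv (D.y j) a) = _
    simp only [← D.S_mul]
    rw [← map_sum, D.sum_conv_mul_of_isDistributive D.isDistributive, D.φ_mul_i,
      ← D.conv_one, D.S_conv, D.S_one, D.S_mul, D.S_i]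

end FrobeniusDoubleRing

namespace FrobeniusDoubleRing

variable {A L R : Type*} [Ring A] [Ring L] [Ring R] (D : FrobeniusDoubleRing A L)
  (ν : L ≃+* Rᵐᵒᵖ)

/-! ### The integral -/

theorem i_mul_Ss (l : L) : D.i * D.S (D.s l) = D.i * D.s l := by
  have h := congrArg D.S (D.t_mul_i l)
  rw [D.S_mul, D.S_mul, D.S.apply_symm_apply, D.S_i] at h
  exact h.symm

theorem i_mul (a : A) : D.i * a = D.i * D.S (D.s (D.φ (D.S.symm a * D.i))) := by
  have h := congrArg D.S (D.mul_i (D.S.symm a))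
  rwa [D.S_mul, D.S_mul, D.S.apply_symm_apply, D.S_i] at h

theorem conv_mul_t (l : L) (a b : A) :
    D.conv a b * D.S.symm (D.s l) = D.conv a (b * D.S.symm (D.s l)) := by
  apply D.S.injective
  simp only [S_mul, S_conv, D.S.apply_symm_apply, D.s_mul_conv]

theorem slide_right (l : L) (a b : A) :
    D.conv (a * D.S (D.s l)) b = D.conv a (b * D.s l) := by
  apply D.S.symm.injective
  simp only [symm_S_mul, symm_S_conv, D.S.symm_apply_apply, D.slide]

/-- The functional `c ↦ ν φ(S⁻¹(c) a)`. -/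
def functional (a : A) : (D.right ν).Dual :=
  ⟨(MulOpposite.opAddEquiv.symm.toAddMonoidHom.comp ν.toRingHom.toAddMonoidHom).comp
    (D.φ.comp ((AddMonoidHom.mulRight a).comp D.S.symm.toAddMonoidHom)), fun c r => by
    change (ν (D.φ (D.S.symm (c * D.S (D.s (ν.symm (.op r)))) * a))).unop =
      (ν (D.φ (D.S.symm c * a))).unop * r
    rw [D.symm_S_mul, D.S.symm_apply_apply, mul_assoc, D.φ_s_mul,
      map_mul, RingEquiv.apply_symm_apply, MulOpposite.unop_mul, MulOpposite.unop_op]⟩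

theorem functional_apply (a c : A) :
    D.functional ν a c = (ν (D.φ (D.S.symm c * a))).unop := rfl

/-- The coefficients `φ(xⱼ a)` reassemble `a` from the dual basis inside `∑ (yⱼ ⋆ c) s(φ(xⱼ a))`. At
`c = i` this makes `functional` a right inverse of `i_R`. -/
theorem functional_act (a c : A) : (D.functional ν a).act c = D.conv a c := by
  rw [RightBialgebroid.Dual.act, AddMonoidHom.comp_apply, D.right_γ_eq_left ν D.isDualBasis,
    map_sum]
  refine Eq.trans (Finset.sum_congr rfl fun j _ => ?_) (D.isDualBasis.sum_conv_mul a c)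
  rw [RightBialgebroid.Dual.actTensor_tmul]
  change _ * D.s (ν.symm (.op (D.functional ν a (D.S (D.x j))))) = _
  rw [functional_apply, MulOpposite.op_unop, RingEquiv.symm_apply_apply, D.S.symm_apply_apply]

/-- Writing `ψ ⇀ i` in the dual basis, the linearity of `ψ` over the source map pulls the
coefficients inside, where they reassemble `c`. -/
theorem functional_act_i (ψ : (D.right ν).Dual) : D.functional ν (ψ.act D.i) = ψ := by
  ext c
  have h : ψ.act D.i = ∑ j, D.y j * D.s (ν.symm (.op (ψ (D.S (D.x j))))) := by
    rw [RightBialgebroid.Dual.act, AddMonoidHom.comp_apply, D.right_γ_eq_left ν D.isDualBasis,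
      map_sum]
    refine Finset.sum_congr rfl fun j _ => ?_
    rw [RightBialgebroid.Dual.actTensor_tmul, D.conv_i]
    rfl
  have hs : ∀ (u : A) (l : L), ψ (u * D.S (D.s l)) = ψ u * (ν l).unop := fun u l => by
    have := ψ.map_mul_s u (ν l).unop
    rwa [show (D.right ν).s (ν l).unop = D.S (D.s (ν.symm (.op (ν l).unop))) from rfl,
      MulOpposite.op_unop, RingEquiv.symm_apply_apply] at this
  rw [functional_apply, h, Finset.mul_sum, map_sum, map_sum, Finset.unop_sum]
  have e : ∀ j, (ν (D.φ (D.S.symm c * (D.y j * D.s (ν.symm (.op (ψ (D.S (D.x j))))))))).unop =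
      ψ (D.S (D.s (D.φ (D.S.symm c * D.y j)) * D.x j)) := fun j => by
    rw [← mul_assoc, D.φ_mul_s, map_mul, MulOpposite.unop_mul, RingEquiv.apply_symm_apply,
      MulOpposite.unop_op, D.S_mul, hs]
  simp only [e]
  rw [← map_sum, ← map_sum, D.isDualBasis.sum_mul, D.S.apply_symm_apply]

/-- The functional `c ↦ ν φ(S⁻¹(a) c)`. -/
def coFunctional (a : A) : (D.right ν).coDual :=
  ⟨(MulOpposite.opAddEquiv.symm.toAddMonoidHom.comp ν.toRingHom.toAddMonoidHom).comp
    (D.φ.comp (AddMonoidHom.mulLeft (D.S.symm a))), fun c r => by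
    change (ν (D.φ (D.S.symm a * (c * D.s (ν.symm (.op r)))))).unop =
      r * (ν (D.φ (D.S.symm a * c))).unop
    rw [← mul_assoc, D.φ_mul_s,
      map_mul, RingEquiv.apply_symm_apply, MulOpposite.unop_mul, MulOpposite.unop_op]⟩

theorem coFunctional_apply (a c : A) :
    (D.coFunctional ν a).1 c = (ν (D.φ (D.S.symm a * c))).unop := rfl

theorem coAct_i (χ : (D.right ν).coDual) :
    (D.right ν).coAct χ D.i = ∑ j, D.S (D.x j) * D.S (D.s (ν.symm (.op (χ.1 (D.y j))))) := by
  rw [RightBialgebroid.coAct, AddMonoidHom.comp_apply, D.right_γ_eq_left ν D.isDualBasis, map_sum]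
  refine Finset.sum_congr rfl fun j _ => ?_
  rw [D.conv_i]
  rfl

theorem coFunctional_coAct_i (χ : (D.right ν).coDual) :
    D.coFunctional ν ((D.right ν).coAct χ D.i) = χ := by
  have hs : ∀ (u : A) (l : L), χ.1 (u * D.s l) = (ν l).unop * χ.1 u := fun u l => by
    have := χ.2 u (ν l).unop
    rwa [show (D.right ν).t (.op (ν l).unop) = D.s (ν.symm (.op (ν l).unop)) from rfl,
      MulOpposite.op_unop, RingEquiv.symm_apply_apply] at this
  refine Subtype.ext (AddMonoidHom.ext fun c => ?_)
  rw [coFunctional_apply, coAct_i, map_sum, Finset.sum_mul, map_sum, map_sum, Finset.unop_sum]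
  have e : ∀ j, (ν (D.φ (D.S.symm (D.S (D.x j) * D.S (D.s (ν.symm (.op (χ.1 (D.y j)))))) *
      c))).unop = χ.1 (D.y j * D.s (D.φ (D.x j * c))) := fun j => by
    rw [← D.S_mul, D.S.symm_apply_apply, mul_assoc, D.φ_s_mul, map_mul, MulOpposite.unop_mul,
      RingEquiv.apply_symm_apply, MulOpposite.unop_op, hs]
  simp only [e]
  rw [← map_sum, D.isDualBasis]

theorem coFunctional_coAct (a : A) : (D.right ν).coAct (D.coFunctional ν a) D.i = a := by
  simp only [coAct_i, coFunctional_apply, MulOpposite.op_unop, RingEquiv.symm_apply_apply,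
    ← D.S_mul]
  rw [← map_sum, D.isDualBasis.sum_mul, D.S.apply_symm_apply]

theorem isNondegenerateIntegral : (D.hopf ν).IsNondegenerateIntegral D.i where
  left_integral a := D.mul_i a
  right_integral a := by
    refine (D.i_mul a).trans ?_
    rw [← D.s_rightπ ν]
    rfl
  bijective_act := Function.bijective_iff_has_inverse.2 ⟨D.functional ν, D.functional_act_i ν,
    fun a => (D.functional_act ν a D.i).trans (D.conv_i a)⟩
  bijective_coAct := Function.bijective_iff_has_inverse.2 ⟨D.coFunctional ν,
    D.coFunctional_coAct_i ν, D.coFunctional_coAct ν⟩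

variable {D ν}

theorem iR_functional (hi : (D.hopf ν).IsNondegenerateIntegral D.i) (a : A) :
    hi.iR (D.functional ν a) = a :=
  (D.functional_act ν a D.i).trans (D.conv_i a)

theorem iR_symm (hi : (D.hopf ν).IsNondegenerateIntegral D.i) (a : A) :
    hi.iR.symm a = D.functional ν a := by
  rw [Equiv.symm_apply_eq, iR_functional]

variable (D)

/-- Transport of structure along an isomorphism of rings. -/
def transport {B : Type*} [Ring B] (e : A ≃+* B) : FrobeniusDoubleRing B L where
  conv := AddMonoidHom.mk' (fun a => AddMonoidHom.mk' (fun b => e (D.conv (e.symm a) (e.symm b)))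
      (fun b b' => by simp only [map_add]))
    (fun a a' => by ext b; simp)
  i := e D.i
  S := (e.symm.toAddEquiv.trans D.S).trans e.toAddEquiv
  s := e.toRingHom.comp D.s
  φ := D.φ.comp e.symm.toRingHom.toAddMonoidHom
  conv_assoc a b c := by simp [D.conv_assoc]
  i_conv a := by simp [D.i_conv]
  conv_i a := by simp [D.conv_i]
  S_mul a b := by simp [D.S_mul]
  S_conv a b := by simp [D.S_conv]
  conv_one a := by simp [D.conv_one]
  s_mul_conv l a b := by simp [← D.s_mul_conv]
  conv_mul_s l a b := by simp [← D.conv_mul_s]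
  slide l a b := by
    have := D.slide l (e.symm a) (e.symm b)
    simp [AddEquiv.symm_trans_apply, this]
  φ_s_mul l a := by simp [D.φ_s_mul]
  φ_i := by simp [D.φ_i]
  mul_i a := by simpa using congrArg e (D.mul_i (e.symm a))
  φ_conv_mul x a y := by simp [D.φ_conv_mul]
  exists_basis := by
    obtain ⟨n, y, x, h⟩ := D.exists_basis
    exact ⟨n, fun j => e (y j), fun j => e (x j), fun p q d c => by simp [h]⟩

end FrobeniusDoubleRing

namespace FrobeniusDoubleRing

/-! ### Dual double rings -/

/-- An additive bijection `F` between double rings that exchanges the two products, the order of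
the composition product being reversed. -/
structure FourierPair {A B L R : Type*} [Ring A] [Ring B] [Ring L] [Ring R]
    (D : FrobeniusDoubleRing A L) (ν : L ≃+* Rᵐᵒᵖ) (D' : FrobeniusDoubleRing B R)
    (ν' : R ≃+* Lᵐᵒᵖ) where
  F : A ≃+ B
  map_conv : ∀ a b, F (D.conv a b) = F a * F b
  conv_map : ∀ a b, D'.conv (F a) (F b) = F (b * a)
  map_i : F D.i = 1
  S_map : ∀ a, D'.S (F a) = F (D.S a)
  s_nu : ∀ l, D'.s (ν l).unop = F (D.i * D.s l)
  s_nu' : ∀ l, D'.s (ν'.symm (.op l)) = F (D.i * D.S.symm (D.s l))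

namespace FourierPair

variable {A B L R : Type*} [Ring A] [Ring B] [Ring L] [Ring R]
  {D : FrobeniusDoubleRing A L} {ν : L ≃+* Rᵐᵒᵖ} {D' : FrobeniusDoubleRing B R}
  {ν' : R ≃+* Lᵐᵒᵖ} (P : FourierPair D ν D' ν')

theorem map_one : P.F 1 = D'.i := by
  obtain ⟨a, ha⟩ := P.F.surjective D'.i
  have h := P.conv_map a 1
  rw [ha, D'.i_conv, one_mul, ha] at h
  exact h

theorem symm_S_map (a : A) : D'.S.symm (P.F a) = P.F (D.S.symm a) := by
  rw [AddEquiv.symm_apply_eq, P.S_map, D.S.apply_symm_apply]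

/-- The source element is the transform of `i s(l)`, and convolving with it slides `s(l)` onto `a`.
Together with `t_mul` this makes tensors of transforms balanced. -/
theorem s_mul (l : L) (a : A) : D'.s (ν l).unop * P.F a = P.F (a * D.s l) := by
  rw [P.s_nu, ← P.map_conv, ← D.i_mul_Ss, D.slide_right, D.i_conv]

theorem t_mul (l : L) (a : A) :
    D'.S.symm (D'.s (ν l).unop) * P.F a = P.F (D.s l * a) := by
  rw [P.s_nu, P.symm_S_map, ← P.map_conv, D.symm_S_mul, D.symm_S_i, D.slide, D.i_conv]

theorem s'φ' (a : A) : D'.s (D'.φ (P.F a)) = P.F (D.i * a) := by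
  rw [← D'.conv_one, ← P.map_i, P.conv_map]

/-- After undoing the transform, the integral property of `i` turns each summand into `S(s(φ(S⁻¹(a)
yⱼ)) xⱼ)`, so the opposite expansion of `S⁻¹(a)` applies. -/
theorem isDualBasis {n : ℕ} {y x : Fin n → A} (h : D.IsDualBasis y x) :
    D'.IsDualBasis (fun j => P.F (D.S (x j))) (fun j => P.F (y j)) := fun b => by
  obtain ⟨a, rfl⟩ := P.F.surjective b
  simp only [← P.map_conv, P.s'φ']
  rw [← map_sum]
  congr 1
  have e : ∀ j, D.conv (D.S (x j)) (D.i * D.conv (y j) a) =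
      D.S (D.s (D.φ (D.S.symm a * y j)) * x j) := fun j => by
    rw [D.i_mul, ← D.conv_mul_Ss, D.conv_i, D.symm_S_conv, D.φ_conv_mul, D.S.apply_symm_apply,
      D.i_conv, D.S_mul]
  simp only [e]
  rw [← map_sum, h.sum_mul, D.S.apply_symm_apply]

theorem left_γ_eq_right {n : ℕ} {y x : Fin n → A} (h : D.IsDualBasis y x) (b : B) :
    D'.left.γ b = ∑ j, BalTensor.tmul D'.left.tLeft D'.left.sLeft
      (D'.conv b (P.F (x j))) (P.F (y j)) := by
  rw [D'.left_γ_eq_right (P.isDualBasis h)]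
  simp only [P.symm_S_map, D.S.symm_apply_apply]

theorem left_γ_eq_left {n : ℕ} {y x : Fin n → A} (h : D.IsDualBasis y x) (b : B) :
    D'.left.γ b = ∑ j, BalTensor.tmul D'.left.tLeft D'.left.sLeft
      (P.F (x j)) (D'.conv (P.F (y j)) b) := by
  rw [D'.left_γ_eq_left (P.isDualBasis h)]
  simp only [P.symm_S_map, D.S.symm_apply_apply]

/-- Dual bases remain dual bases under `S⁻²`; this shift brings the formula to `F S⁻¹`, which is
`ℱ̇` in the application. -/
theorem right_γ_eq_right {n : ℕ} {y x : Fin n → A} (h : D.IsDualBasis y x) (b : B) :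
    (D'.right ν').γ b = ∑ j, BalTensor.tmul (D'.right ν').sRight (D'.right ν').tRight
      (D'.conv b (P.F (D.S.symm (y j)))) (P.F (D.S.symm (x j))) := by
  rw [D'.right_γ_eq_right ν' (P.isDualBasis h.symm_S_sq)]
  simp only [P.S_map, D.S.apply_symm_apply]

theorem right_γ_eq_left {n : ℕ} {y x : Fin n → A} (h : D.IsDualBasis y x) (b : B) :
    (D'.right ν').γ b = ∑ j, BalTensor.tmul (D'.right ν').sRight (D'.right ν').tRight
      (P.F (D.S.symm (y j))) (D'.conv (P.F (D.S.symm (x j))) b) := by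
  rw [D'.right_γ_eq_left ν' (P.isDualBasis h.symm_S_sq)]
  simp only [P.S_map, D.S.apply_symm_apply]

theorem left_π (a : A) : D'.left.π (P.F a) = (ν (D.φ a)).unop := by
  apply D'.s_injective
  change D'.s (D'.φ (P.F a * D'.i)) = _
  rw [← P.map_one, ← P.map_conv, P.s'φ', P.s_nu, D.conv_one]

/-- The two base isomorphisms compose to `S²` on the image of `s`: the source elements at `ν(l)` and
`ν'⁻¹(l')` agree once `S² s(l) = s(l')`. -/
theorem right_π (a : A) : (D'.right ν').π (P.F a) = D.φ (D.S a) := by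
  change (ν' (D'.left.π (D'.S.symm (P.F a)))).unop = _
  rw [P.symm_S_map, P.left_π]
  apply MulOpposite.op_injective
  rw [MulOpposite.op_unop, ← ν'.eq_symm_apply]
  apply D'.s_injective
  rw [P.s_nu, P.s_nu', ← D.i_mul_Ss]
  congr 2
  rw [AddEquiv.eq_symm_apply, D.SS_sφ, D.S.apply_symm_apply]

/-- The map `c ⊗ d ↦ F(S⁻¹(c) a) ⊗ F(d)` is balanced, so any representative of the coproduct of `i`
may be replaced by `∑ S(xⱼ) ⊗ yⱼ`, where the formula is the one already known. -/
theorem left_γ_map (a : A) {n : ℕ} (u v : Fin n → A)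
    (h : (D.right ν).γ D.i = ∑ j, BalTensor.tmul _ _ (u j) (v j)) :
    D'.left.γ (P.F a) = ∑ j, BalTensor.tmul D'.left.tLeft D'.left.sLeft
      (P.F (D.S.symm (u j) * a)) (P.F (v j)) := by
  let T : (D.right ν).RightTensor →+ D'.left.LeftTensor := BalTensor.lift
    (((BalTensor.tmulHom D'.left.tLeft D'.left.sLeft).comp (P.F.toAddMonoidHom.comp
      ((AddMonoidHom.mulRight a).comp D.S.symm.toAddMonoidHom))).compl₂ P.F.toAddMonoidHom)
    (fun r c d => by
      change BalTensor.tmul _ _ (P.F (D.S.symm (c * D.S (D.s (ν.symm (.op r)))) * a)) (P.F d) =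
        BalTensor.tmul _ _ (P.F (D.S.symm c * a)) (P.F (d * D.s (ν.symm (.op r))))
      rw [← P.s_mul, D.symm_S_mul, D.S.symm_apply_apply, mul_assoc, ← P.t_mul]
      exact D'.left_balanced _ _ _)
  have hT : ∀ c d, T (BalTensor.tmul _ _ c d) =
    BalTensor.tmul _ _ (P.F (D.S.symm c * a)) (P.F d) := fun _ _ => rfl
  have e := congrArg T h
  rw [D.right_γ_eq_left ν D.isDualBasis] at e
  simp only [map_sum, hT, D.S.symm_apply_apply, D.conv_i] at e
  rw [← e, P.left_γ_eq_right D.isDualBasis]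
  simp only [P.conv_map]

/-- Same argument with `c ⊗ d ↦ F(S(d) a) ⊗ F(c)`, compared at the dual basis shifted by `S²`. -/
theorem right_γ_map (a : A) {n : ℕ} (u v : Fin n → A)
    (h : (D.right ν).γ D.i = ∑ j, BalTensor.tmul _ _ (u j) (v j)) :
    (D'.right ν').γ (P.F a) = ∑ j, BalTensor.tmul (D'.right ν').sRight (D'.right ν').tRight
      (P.F (D.S (v j) * a)) (P.F (u j)) := by
  have hb : ∀ (l : L) (c d : A), BalTensor.tmul (D'.right ν').sRight (D'.right ν').tRight
      (P.F (D.S.symm (D.s l) * c)) (P.F d) =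
        BalTensor.tmul _ _ (P.F c) (P.F (d * D.S.symm (D.s l))) := fun l c d => by
    have e := BalTensor.balanced (ρ := (D'.right ν').sRight) (κ := (D'.right ν').tRight) l
      (P.F c) (P.F d)
    have hs : (D'.right ν').sRight l (P.F c) = P.F (D.S.symm (D.s l) * c) := by
      change P.F c * D'.S (D'.s (ν'.symm (.op l))) = _
      rw [P.s_nu', P.S_map, D.S_mul, D.S.apply_symm_apply, D.S_i, ← P.map_conv, ← D.slide,
        D.conv_i]
    have ht : (D'.right ν').tRight l (P.F d) = P.F (d * D.S.symm (D.s l)) := by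
      change P.F d * D'.s (ν'.symm (.op l)) = _
      rw [P.s_nu', ← P.map_conv, ← D.conv_mul_t, D.conv_i]
    rwa [hs, ht] at e
  let T : (D.right ν).RightTensor →+ (D'.right ν').RightTensor := BalTensor.lift
    (((BalTensor.tmulHom (D'.right ν').sRight (D'.right ν').tRight).comp
      (P.F.toAddMonoidHom.comp ((AddMonoidHom.mulRight a).comp D.S.toAddMonoidHom))).compl₂
        P.F.toAddMonoidHom).flip
    (fun r c d => by
      change BalTensor.tmul _ _ (P.F (D.S d * a)) (P.F (c * D.S (D.s (ν.symm (.op r))))) =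
        BalTensor.tmul _ _ (P.F (D.S (d * D.s (ν.symm (.op r))) * a)) (P.F c)
      rw [D.S_mul, mul_assoc, D.Ss_eq_t, hb])
  have hT : ∀ c d, T (BalTensor.tmul _ _ c d) =
    BalTensor.tmul _ _ (P.F (D.S d * a)) (P.F c) := fun _ _ => rfl
  have e := congrArg T h
  rw [D.right_γ_eq_left ν D.isDualBasis] at e
  simp only [map_sum, hT, D.conv_i] at e
  rw [← e, P.right_γ_eq_right D.isDualBasis.S_sq]
  simp only [P.conv_map, D.S.symm_apply_apply]

theorem isDual {D'' : FrobeniusDoubleRing (D.right ν).Dual R} (P : FourierPair D ν D'' ν')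
    (hP : ∀ a, P.F a = D.functional ν a) (hi : (D.hopf ν).IsNondegenerateIntegral D.i) :
    HopfAlgebroid.IsDual hi (D''.hopf ν') where
  left_s r a := by
    change D''.s r a = r * D.rightπ ν a
    have h := P.s_nu (ν.symm (.op r))
    rw [RingEquiv.apply_symm_apply, MulOpposite.unop_op, hP] at h
    rw [h, functional_apply, ← mul_assoc, D.φ_mul_s, map_mul, MulOpposite.unop_mul,
      RingEquiv.apply_symm_apply, MulOpposite.unop_op, rightπ_apply]
  left_t r a := by
    change D''.S.symm (D''.s r) a = D.rightπ ν (D.S (D.s (ν.symm (.op r))) * a)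
    have h := P.s_nu (ν.symm (.op r))
    rw [RingEquiv.apply_symm_apply, MulOpposite.unop_op] at h
    rw [h, P.symm_S_map, hP, functional_apply, D.symm_S_mul, D.symm_S_i, D.t_mul_i, rightπ_apply,
      D.symm_S_mul, D.S.symm_apply_apply, mul_assoc]
  left_γ n u v h ψ := by
    obtain ⟨a, rfl⟩ := P.F.surjective ψ
    refine (P.left_γ_map a u v h).trans (Finset.sum_congr rfl fun j _ => ?_)
    rw [iR_symm, ← hP]
    congr 1
    -- Precomposing the functional of `a` with left multiplication by `u` gives the functional of
    -- `S⁻¹(u) a`.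
    ext c
    rw [hP, hP]
    change (ν _).unop = (ν (D.φ (D.S.symm (u j * c) * a))).unop
    rw [D.symm_S_mul, mul_assoc]
    rfl
  left_π ψ := by
    obtain ⟨a, rfl⟩ := P.F.surjective ψ
    refine (P.left_π a).trans ?_
    rw [hP, functional_apply, D.symm_S_one, one_mul]
  right_s l a := by
    change D''.S (D''.s (ν'.symm (.op l))) a = D.rightπ ν (D.s l * a)
    rw [P.s_nu', P.S_map, D.S_mul, D.S.apply_symm_apply, D.S_i, hP, functional_apply, rightπ_apply,
      D.symm_S_mul, mul_assoc, D.t_mul_i]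
  right_t l a := by
    rw [HopfAlgebroid.IsNondegenerateIntegral.dualIntegral, iR_symm]
    change D''.s (ν'.symm (.op l)) a =
      D.functional ν 1 (D.S (D.i * D.S.symm (D.s l)) * a)
    rw [P.s_nu', hP, functional_apply, functional_apply, D.symm_S_mul, D.S.symm_apply_apply,
      mul_one]
  right_γ n u v h ψ := by
    obtain ⟨a, rfl⟩ := P.F.surjective ψ
    refine (P.right_γ_map a u v h).trans (Finset.sum_congr rfl fun j _ => ?_)
    rw [iR_symm, ← hP]
    congr 1
    ext c
    rw [hP, hP]
    change (ν _).unop = (ν (D.φ (D.S.symm (D.S (D.S (v j)) * c) * a))).unop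
    rw [D.symm_S_mul, mul_assoc, D.S.symm_apply_apply]
    rfl
  right_π ψ := by
    obtain ⟨a, rfl⟩ := P.F.surjective ψ
    refine (P.right_π a).trans ?_
    -- The dual integral is the functional of `1`, so its product with `ψ` is the functional of `1 ⋆
    -- a`; evaluated at `i` it reduces to `φ(S(a))`.
    rw [HopfAlgebroid.IsNondegenerateIntegral.dualIntegral, iR_symm, ← hP, ← P.map_conv, hP]
    change _ = D.φ (D.S (D.s (ν.symm (.op (ν (D.φ (D.S.symm D.i * D.conv 1 a))).unop))) * D.i)
    have h1 : D.conv 1 a = D.S (D.s (D.φ (D.S.symm a))) := by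
      rw [← D.conv_one, D.S_conv, D.S_one, D.S.apply_symm_apply]
    rw [MulOpposite.op_unop, RingEquiv.symm_apply_apply, D.symm_S_i, h1, D.i_mul_Ss, D.φ_mul_s,
      D.φ_i, one_mul]
    have h2 : D.S (D.s (D.φ (D.S.symm a))) = D.S.symm (D.s (D.φ (D.S a))) := by
      rw [AddEquiv.eq_symm_apply, D.SS_sφ, D.S.apply_symm_apply]
    rw [h2, D.t_mul_i, D.φ_s_mul_i]
  antipode ψ := by
    obtain ⟨a, rfl⟩ := P.F.surjective ψ
    refine (P.S_map a).trans ?_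
    rw [iR_symm, hP, hP, iR_functional]

end FourierPair

/-- A Fourier pair followed by a transport of structure. -/
def FourierPair.transport {A B B' L R : Type*} [Ring A] [Ring B] [Ring B'] [Ring L] [Ring R]
    {D : FrobeniusDoubleRing A L} {ν : L ≃+* Rᵐᵒᵖ} {D' : FrobeniusDoubleRing B R}
    {ν' : R ≃+* Lᵐᵒᵖ} (P : FourierPair D ν D' ν') (e : B ≃+* B') :
    FourierPair D ν (D'.transport e) ν' where
  F := P.F.trans e.toAddEquiv
  map_conv a b := by simp [P.map_conv]
  conv_map a b := by simp [FrobeniusDoubleRing.transport, P.conv_map]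
  map_i := by simp [P.map_i]
  S_map a := by simp [FrobeniusDoubleRing.transport, P.S_map]
  s_nu l := congrArg e (P.s_nu l)
  s_nu' l := congrArg e (P.s_nu' l)

theorem IsDualBasis.transport {A B L : Type*} [Ring A] [Ring B] [Ring L]
    {D : FrobeniusDoubleRing A L} {n : ℕ} {y x : Fin n → A} (h : D.IsDualBasis y x)
    (e : A ≃+* B) :
    (D.transport e).IsDualBasis (fun j => e (y j)) (fun j => e (x j)) := fun b => by
  have := congrArg e (h (e.symm b))
  simpa [FrobeniusDoubleRing.transport] using this

theorem transport_isStrictIso {A B L R : Type*} [Ring A] [Ring B] [Ring L] [Ring R]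
    (D : FrobeniusDoubleRing A L) (ν : L ≃+* Rᵐᵒᵖ) (e : A ≃+* B) :
    (D.hopf ν).IsStrictIso ((D.transport e).hopf ν) e.toRingHom (RingHom.id L) where
  isHom :=
    { s := fun l => rfl
      t := fun l => by
        change e (D.S.symm (e.symm (e (D.s l)))) = e (D.S.symm (D.s l))
        rw [e.symm_apply_apply]
      π := fun a => by
        change D.φ (e.symm (e a * e D.i)) = D.φ (a * D.i)
        rw [map_mul, e.symm_apply_apply, e.symm_apply_apply]
      γ := fun a => by
        rw [(D.transport e).left_γ_eq_left (D.isDualBasis.transport e),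
          D.left_γ_eq_left D.isDualBasis, map_sum]
        refine Finset.sum_congr rfl fun j _ => ?_
        change BalTensor.tmul _ _ (e (D.S.symm (e.symm (e (D.y j)))))
          (e (D.conv (e.symm (e (D.x j))) (e.symm (e a)))) =
          BalTensor.tmul _ _ (e (D.S.symm (D.y j))) (e (D.conv (D.x j) a))
        simp only [e.symm_apply_apply] }
  bijective_total := e.bijective
  bijective_base := Function.bijective_id
  strict a := by
    change e (D.S a) = e (D.S (e.symm (e a)))
    rw [e.symm_apply_apply]

/-- The isomorphism of rings from the dual double ring to the dual of the right bialgebroid. -/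
noncomputable def FourierPair.dualEquiv {A B L R : Type*} [Ring A] [Ring B] [Ring L] [Ring R]
    {D : FrobeniusDoubleRing A L} {ν : L ≃+* Rᵐᵒᵖ} {D' : FrobeniusDoubleRing B R}
    {ν' : R ≃+* Lᵐᵒᵖ} (P : FourierPair D ν D' ν') : B ≃+* (D.right ν).Dual :=
  RingEquiv.ofBijective
    ({ toFun := fun b => D.functional ν (P.F.symm b)
       map_one' := by
        rw [← P.map_i, P.F.symm_apply_apply]
        rfl
       map_mul' := fun b b' => by
        obtain ⟨a, rfl⟩ := P.F.surjective b
        obtain ⟨a', rfl⟩ := P.F.surjective b'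
        rw [← P.map_conv, P.F.symm_apply_apply, P.F.symm_apply_apply, P.F.symm_apply_apply]
        ext c
        -- The dual product evaluates the first functional at `a' ⋆ c`; `φ_conv_mul` moves `a'` next
        -- to `a`, giving the functional of `a ⋆ a'`.
        rw [RightBialgebroid.Dual.mul_apply, functional_act, functional_apply, functional_apply,
          D.symm_S_conv, D.φ_conv_mul, D.S.apply_symm_apply]
       map_zero' := by
        ext c
        rw [map_zero, functional_apply, mul_zero, map_zero, map_zero]
        rfl
       map_add' := fun b b' => by
        ext c
        rw [RightBialgebroid.Dual.add_apply]
        simp only [functional_apply, map_add, mul_add, MulOpposite.unop_add] } :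
      B →+* (D.right ν).Dual)
    ((Function.bijective_iff_has_inverse.2 ⟨fun ψ => ψ.act D.i,
      fun a => (D.functional_act ν a D.i).trans (D.conv_i a), D.functional_act_i ν⟩ :
        Function.Bijective (D.functional ν)).comp P.F.symm.bijective)

end FrobeniusDoubleRing

/-! ### The double rings of `ι` and `ῑ`, and the theorem -/

namespace FrobeniusData

variable {C : Type u} [Bicategory.{w, v} C] [∀ a b : C, Preadditive (a ⟶ b)]
  [PreadditiveBicategory C] {X Y : C} {ι : X ⟶ Y} (F : FrobeniusData ι)

/-- The isomorphism `ν : L → Rᵒᵖ`. -/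
def nuEquiv : F.L ≃+* F.Rᵐᵒᵖ where
  toFun l := .op (F.nu l)
  invFun r := F.nuInv r.unop
  left_inv l := F.nuInv_nu l
  right_inv r := congrArg MulOpposite.op (F.nu_nuInv r.unop)
  map_mul' l l' := congrArg MulOpposite.op (F.nu_mul l l')
  map_add' l l' := congrArg MulOpposite.op (F.nu_add l l')

/-- The antipode `S_A` as an additive bijection. -/
def SAEquiv : F.A ≃+ F.A where
  toFun := F.SA
  invFun := F.SAInv
  left_inv := F.SAInv_SA
  right_inv := F.SA_SAInv
  map_add' a b := by rw [SA, fourier_add, fourierDotInv_add, SA, SA]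

/-- The Fourier transformation as an additive bijection. -/
def fourierEquiv : F.A ≃+ F.B where
  toFun := F.fourier
  invFun := F.fourierInv
  left_inv := F.fourierInv_fourier
  right_inv := F.fourier_fourierInv
  map_add' := F.fourier_add

/-- The ring homomorphism `l ↦ l × ῑ`. -/
def sourceHom : F.L →+* F.A where
  toFun l := End.of (l.asHom ▷ F.bar)
  map_one' := id_whiskerRight ι F.bar
  map_mul' l l' := comp_whiskerRight l'.asHom l.asHom F.bar
  map_zero' := (AddMonoidHom.mk' (fun x : ι ⟶ ι => x ▷ F.bar)
    (fun x y => PreadditiveBicategory.add_whiskerRight x y F.bar)).map_zero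
  map_add' l l' := PreadditiveBicategory.add_whiskerRight l.asHom l'.asHom F.bar

/-- The double ring on `A`. -/
def doubleRing (hF : ∃ (n : ℕ) (y x : Fin n → F.A), F.IsQuasiBasis y x) :
    FrobeniusDoubleRing F.A F.L where
  conv := AddMonoidHom.mk' (fun a => AddMonoidHom.mk' (F.convA a) (F.convA_add a))
    (fun a b => AddMonoidHom.ext fun c => F.add_convA a b c)
  i := F.iA
  S := F.SAEquiv
  s := F.sourceHom
  φ := AddMonoidHom.mk' F.phiL F.phiL_add
  conv_assoc := F.convA_assoc
  i_conv := F.iA_convA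
  conv_i := F.convA_iA
  S_mul := F.SA_mul
  S_conv := F.SA_convA
  conv_one := F.convA_one
  s_mul_conv := F.whiskerRight_mul_convA
  conv_mul_s := F.convA_mul_whiskerRight
  slide l a b := by
    change F.convA (F.SAInv (l.asHom ▷ F.bar) * a) b = _
    rw [SAInv_whiskerRight]
    exact F.convA_slide l a b
  φ_s_mul := F.phiL_whiskerRight_mul
  φ_i := F.phiL_iA
  mul_i := F.mul_iA
  φ_conv_mul := F.phiL_convA_mul
  exists_basis := by
    obtain ⟨n, y, x, h⟩ := hF
    exact ⟨n, y, x, h.convA_mul⟩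

variable {F}

theorem IsQuasiBasis.isDualBasis (hF : ∃ (n : ℕ) (y x : Fin n → F.A), F.IsQuasiBasis y x) {n : ℕ}
    {y x : Fin n → F.A} (h : F.IsQuasiBasis y x) : (F.doubleRing hF).IsDualBasis y x :=
  FrobeniusDoubleRing.IsDistributive.isDualBasis (D := F.doubleRing hF) h.convA_mul

variable (F)

theorem isHopfA (hF : ∃ (n : ℕ) (y x : Fin n → F.A), F.IsQuasiBasis y x) :
    F.IsHopfA ((F.doubleRing hF).hopf F.nuEquiv) where
  left_s l := rfl
  left_t l := F.SAInv_whiskerRight l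
  left_γ n y x h a :=
    ⟨(F.doubleRing hF).left_γ_eq_right (h.isDualBasis hF) a,
      (F.doubleRing hF).left_γ_eq_left (h.isDualBasis hF) a⟩
  left_π a := rfl
  right_s r := (F.SA_whiskerRight (F.nuInv r)).trans (by rw [nu_nuInv])
  right_t r := rfl
  right_γ n y x h a :=
    ⟨(F.doubleRing hF).right_γ_eq_right F.nuEquiv (h.isDualBasis hF) a,
      (F.doubleRing hF).right_γ_eq_left F.nuEquiv (h.isDualBasis hF) a⟩
  right_π a := rfl
  antipode a := rfl

/-- The Fourier transformation relates the double rings of `ι` and `ῑ`. -/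
def fourierPair (hF : ∃ (n : ℕ) (y x : Fin n → F.A), F.IsQuasiBasis y x)
    (hF' : ∃ (n : ℕ) (y x : Fin n → F.flip.A), F.flip.IsQuasiBasis y x) :
    FrobeniusDoubleRing.FourierPair (F.doubleRing hF) F.nuEquiv (F.flip.doubleRing hF')
      F.flip.nuEquiv where
  F := F.fourierEquiv
  map_conv := F.fourier_convA
  conv_map a b := (F.flip_convA _ _).trans (F.convB_fourier a b)
  map_i := F.fourier_iA
  S_map a := by
    change F.flip.fourierDotInv (F.flip.fourier (F.fourier a)) = F.fourier (F.SA a)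
    rw [flip_fourierDotInv, flip_fourier, SA]
  s_nu l := (F.fourier_iA_mul_whiskerRight l).symm
  s_nu' l := by
    -- Taking `ν⁻¹ μ(l)` as label writes `ι × μ(l)` in the form `S s`, which the integral absorbs as
    -- `s`.
    have h := (F.doubleRing hF).i_mul_Ss (F.nuInv (F.mu l))
    change F.iA * F.SA ((F.nuInv (F.mu l)).asHom ▷ F.bar) =
      F.iA * End.of ((F.nuInv (F.mu l)).asHom ▷ F.bar) at h
    rw [SA_whiskerRight, nu_nuInv] at h
    change F.flip.nuInv l ▷ ι = F.fourier (F.iA * F.SAInv (l.asHom ▷ F.bar))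
    rw [SAInv_whiskerRight, h, fourier_iA_mul_whiskerRight, nu_nuInv, flip_nuInv]

theorem isHopfB (hF : ∃ (n : ℕ) (y x : Fin n → F.A), F.IsQuasiBasis y x)
    (hF' : ∃ (n : ℕ) (y x : Fin n → F.flip.A), F.flip.IsQuasiBasis y x) :
    F.IsHopfB ((F.flip.doubleRing hF').hopf F.flip.nuEquiv) where
  left_s r := rfl
  left_t r := (F.flip.SAInv_whiskerRight r).trans (by rw [flip_mu])
  left_γ n y x h b := by
    have h1 := (F.fourierPair hF hF').left_γ_eq_right (h.isDualBasis hF) b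
    have h2 := (F.fourierPair hF hF').left_γ_eq_left (h.isDualBasis hF) b
    simp only [← flip_convA]
    exact ⟨h1, h2⟩
  left_π b := by
    have h := (F.fourierPair hF hF').left_π (F.fourierInv b)
    rw [show (F.fourierPair hF hF').F (F.fourierInv b) = b from F.fourier_fourierInv b] at h
    exact h
  right_s l := (F.flip.SA_whiskerRight (F.flip.nuInv l)).trans (by rw [nu_nuInv])
  right_t l := by
    change F.flip.nuInv l ▷ ι = _
    rw [flip_nuInv]
  right_γ n y x h b := by
    have h1 := (F.fourierPair hF hF').right_γ_eq_right (h.isDualBasis hF) b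
    have h2 := (F.fourierPair hF hF').right_γ_eq_left (h.isDualBasis hF) b
    have e : ∀ a, F.fourierDot a = F.fourier (F.SAInv a) := fun a => by
      rw [SAInv, fourier_fourierInv]
    simp only [← flip_convA, e]
    exact ⟨h1, h2⟩
  right_π b := by
    have h := (F.fourierPair hF hF').right_π (F.fourierInv b)
    rw [show (F.fourierPair hF hF').F (F.fourierInv b) = b from F.fourier_fourierInv b] at h
    refine h.trans ?_
    change F.phiL (F.fourierDotInv (F.fourier (F.fourierInv b))) = _
    rw [fourier_fourierInv]
  antipode b := by
    change F.flip.fourierDotInv (F.flip.fourier b) = _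
    rw [flip_fourierDotInv, flip_fourier, SB]

end FrobeniusData

theorem mainTheorem3 {C : Type u} [Bicategory.{w, v} C] [∀ a b : C, Preadditive (a ⟶ b)]
    [PreadditiveBicategory C] [∀ a b : C, HasFiniteBiproducts (a ⟶ b)]
    {X Y : C} {ι : X ⟶ Y} (F : FrobeniusData ι) (hF : F.IsD2) :
    (∃ (n : ℕ) (y x : Fin n → F.A), F.IsQuasiBasis y x) ∧
    ∃ (𝒜 : HopfAlgebroid F.A F.L F.R) (ℬ : HopfAlgebroid F.B F.R F.L),
      F.IsHopfA 𝒜 ∧ F.IsHopfB ℬ ∧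
      ∃ (hi : 𝒜.IsNondegenerateIntegral F.iA) (𝒟 : HopfAlgebroid 𝒜.right.Dual F.R F.L),
        HopfAlgebroid.IsDual hi 𝒟 ∧
        ∃ α : F.B →+* 𝒜.right.Dual,
          (∀ b a, α b a = F.nu (F.phiL (F.SAInv a * F.fourierInv b))) ∧
          ℬ.IsStrictIso 𝒟 α (RingHom.id F.R) := by
  have h := F.exists_isQuasiBasis hF
  have h' := F.flip.exists_isQuasiBasis ⟨hF.2, hF.1⟩
  let P := F.fourierPair h h'
  refine ⟨h, (F.doubleRing h).hopf F.nuEquiv, (F.flip.doubleRing h').hopf F.flip.nuEquiv,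
    F.isHopfA h, F.isHopfB h h', (F.doubleRing h).isNondegenerateIntegral F.nuEquiv,
    ((F.flip.doubleRing h').transport P.dualEquiv).hopf F.flip.nuEquiv,
    -- After the transport the Fourier map sends `a` to its functional, because `α*` is defined
    -- through `ℱ⁻¹`; this is the remaining goal.
    (P.transport P.dualEquiv).isDual (fun a => ?_) _, P.dualEquiv.toRingHom, fun b a => rfl,
    (F.flip.doubleRing h').transport_isStrictIso F.flip.nuEquiv P.dualEquiv⟩
  exact congrArg ((F.doubleRing h).functional F.nuEquiv) (P.F.symm_apply_apply a)
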